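/- **Setting.** A *vacuum graph* $\mathcal G$ of the coloured Boulatov model is a finite closed bipartite 4-coloured graph: white nodes $W$, black nodes $B$, and for each colour $\ell\in\{1,2,3,4\}$ a bijection $W\to B$ (the lines of colour $\ell$; multiple lines are allowed), so that every node carries exactly one line of each colour. Let $\mathcal N=|W|+|B|=2|W|$. In the dual simplicial complex, nodes are tetrahedra and lines of colour $\ell$ are triangles of colour $\ell$; in each tetrahedron the vertex opposite to the triangle of colour $\ell$ also has colour $\ell$. *Amplitude.* Let $dg$ be the normalised Haar measure on $SU(2)$ and, for $t>0$, $\delta_t(g)=\sum_{j\in\mathbb N/2}(2j+1)e^{-tj(j+1)}\chi_j(g)$ the heat kernel. To each line $f$ of colour $\ell$ associate three variables $G^f_v\in SU(2)$, indexed by the colours $v\neq\ell$ of the vertices of the dual triangle. For a node $n$ write $G^{\ell}_{v}(n)=G^{f}_{v}$, where $f$ is the line of colour $\ell$ at $n$. Let $o_1=(2,3,4)$, $o_2=(4,3,1)$, $o_3=(4,1,2)$, $o_4=(1,3,2)$. For $\lambda\in\mathbb C$ the regularised amplitude is $$\mathcal A_t^{\mathcal G}(\lambda)=(\lambda\bar\lambda)^{\mathcal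 N/2}\int\prod_{f}\Big(\delta\big(G^f_{a}G^f_{b}G^f_{c}\big)\,dG^f_{a}\,dG^f_{b}\,dG^f_{c}\Big)_{(a,b,c)=o_{\ell(f)}}\ \prod_{n\in W\sqcup B}\frac{1}{\delta_t(1)}\prod_{v=1}^4\delta_t\big(G^{a}_v(n)\,G^{b}_v(n)\,G^{c}_v(n)\big)_{(a,b,c)=o_v},$$ where $f$ runs over the lines, $\ell(f)$ is the colour of $f$, and $\delta(G_1G_2G_3)\,dG_1dG_2dG_3$ is the image of $dx\,dy$ under $(x,y)\mapsto(x,y,(xy)^{-1})$. After the rescaling $\lambda\to\lambda/\sqrt{\delta_t(1)}$ of the coupling constant, the divergence degree is $$\gamma_{\mathcal G}=\inf\Big\{\gamma\in\mathbb R\ :\ \lim_{t\to0^+}\delta_t(1)^{-\gamma}\,\mathcal A^{\mathcal G}_t\big(\lambda/\sqrt{\delta_t(1)}\big)\ \text{exists and is finite}\Big\}\in[-\infty,+\infty].$$ *Jackets.* A jacket $J$ is labelled by a pair $(\sigma,\sigma^{-1})$ of cyclic permutations of the four colours (there are three). It is the closed quadrangulated surface made of one rectangle per tetrahedron: its corners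 are the midpoints of the four edges whose end points have colours $c,\sigma(c)$, and for each colour $c$ one side, lying in the triangle with vertices of colours $c,\sigma(c),\sigma^2(c)$, joins the midpoints of the edges $(c,\sigma(c))$ and $(\sigma(c),\sigma^2(c))$. Rectangles are glued along sides as the tetrahedra are glued along triangles. Its genus $g_J$ is defined by $2-2g_J=\chi_J=|\mathcal F_J|-|\mathcal E_J|+|\mathcal V_J|$, with $\mathcal F_J,\mathcal E_J,\mathcal V_J$ the faces, edges and vertices of the surface. **Proposition.** For every connected vacuum graph $\mathcal G$ and every $\lambda\in\mathbb C$, with the above rescaling, $$\gamma_{\mathcal G}\le 2-g_J\qquad\text{for every jacket }J .$$ In particular $$\gamma_{\mathcal G}\le 2-\sup_J g_J .$$ This is at least as strong as the averaged bound, since $2-\sup_J g_J\le 2-\tfrac13\sum_J g_J$; hence also $\gamma_{\mathcal G}\le 2-\tfrac13\sum_J g_J$. -/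

import Mathlib

open MeasureTheory Filter Topology

noncomputable section

namespace Boulatov

/-! ### The group `SU(2)` and its normalised Haar measure -/

/-- The compact group `SU(2)`. -/
abbrev SU2 : Type := Matrix.specialUnitaryGroup (Fin 2) ℂ

instance : ContinuousInv SU2 where
  continuous_inv := by
    have h : Continuous fun g : SU2 => star (g : Matrix (Fin 2) (Fin 2) ℂ) :=
      continuous_star.comp continuous_subtype_val
    exact h.subtype_mk _

instance : IsTopologicalGroup SU2 where

instance : CompactSpace SU2 := by
  have hent : ∀ A ∈ (Matrix.specialUnitaryGroup (Fin 2) ℂ : Set (Matrix (Fin 2) (Fin 2) ℂ)),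
      A ∈ Set.pi Set.univ
        (fun _ : Fin 2 => Set.pi Set.univ fun _ : Fin 2 => Metric.closedBall (0 : ℂ) 1) := by
    intro A hA i _ j _
    rw [mem_closedBall_zero_iff]
    exact entry_norm_bound_of_unitary (Matrix.specialUnitaryGroup_le_unitaryGroup hA) i j
  have hK : IsCompact (Set.pi Set.univ
      (fun _ : Fin 2 => Set.pi Set.univ fun _ : Fin 2 => Metric.closedBall (0 : ℂ) 1)) :=
    isCompact_univ_pi fun _ => isCompact_univ_pi fun _ => isCompact_closedBall 0 1
  have hc : IsClosed (Matrix.specialUnitaryGroup (Fin 2) ℂ : Set (Matrix (Fin 2) (Fin 2) ℂ)) := by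
    have h1 : IsClosed (Matrix.unitaryGroup (Fin 2) ℂ : Set (Matrix (Fin 2) (Fin 2) ℂ)) :=
      isClosed_unitary
    have h2 : IsClosed {A : Matrix (Fin 2) (Fin 2) ℂ | A.det = 1} :=
      isClosed_eq (Continuous.matrix_det continuous_id) continuous_const
    have h3 : (Matrix.specialUnitaryGroup (Fin 2) ℂ : Set (Matrix (Fin 2) (Fin 2) ℂ)) =
        (Matrix.unitaryGroup (Fin 2) ℂ : Set (Matrix (Fin 2) (Fin 2) ℂ)) ∩ {A | A.det = 1} := by
      ext A
      exact Matrix.mem_specialUnitaryGroup_iff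
    rw [h3]
    exact h1.inter h2
  exact isCompact_iff_compactSpace.mp (hK.of_isClosed_subset hc hent)

instance : MeasurableSpace SU2 := borel SU2

instance : BorelSpace SU2 := ⟨rfl⟩

/-- The Haar measure `dg` of total mass one on `SU(2)`. -/
def haar : Measure SU2 := Measure.haarMeasure ⊤

/-! ### Characters and heat kernel -/

/-- The linear substitution `X_i ↦ ∑_j g_{ji} X_j` on polynomials in two variables. -/
def substitution (g : SU2) : MvPolynomial (Fin 2) ℂ →ₐ[ℂ] MvPolynomial (Fin 2) ℂ :=
  MvPolynomial.aeval fun i => ∑ j, MvPolynomial.C ((g : Matrix (Fin 2) (Fin 2) ℂ) j i) *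
    MvPolynomial.X j

theorem substitution_mem (g : SU2) (n : ℕ) (p : MvPolynomial (Fin 2) ℂ)
    (hp : p ∈ MvPolynomial.homogeneousSubmodule (Fin 2) ℂ n) :
    (substitution g).toLinearMap p ∈ MvPolynomial.homogeneousSubmodule (Fin 2) ℂ n := by
  have h := MvPolynomial.IsHomogeneous.aeval (m := n) (n := 1) (φ := p) hp
    (fun i => ∑ j, MvPolynomial.C ((g : Matrix (Fin 2) (Fin 2) ℂ) j i) * MvPolynomial.X j)
    (fun i => MvPolynomial.IsHomogeneous.sum _ _ _ fun j _ =>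
      MvPolynomial.isHomogeneous_C_mul_X _ _)
  simpa [substitution] using h

theorem substitution_one : substitution 1 = AlgHom.id ℂ _ := by
  apply MvPolynomial.algHom_ext
  intro i
  simp [substitution, Matrix.one_apply]

theorem substitution_mul (g h : SU2) :
    substitution (g * h) = (substitution g).comp (substitution h) := by
  apply MvPolynomial.algHom_ext
  intro i
  fin_cases i <;>
    simp [substitution, Matrix.mul_apply, Fin.sum_univ_two] <;> ring

/-- The irreducible representation of `SU(2)` of spin `n / 2`, on the homogeneous polynomials of
degree `n` in two variables (the `n`-th symmetric power of the defining representation). -/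
def spinRep (n : ℕ) :
    Representation ℂ SU2 (MvPolynomial.homogeneousSubmodule (Fin 2) ℂ n) where
  toFun g := (substitution g).toLinearMap.restrict (substitution_mem g n)
  map_one' := by
    ext p : 2
    exact congrArg (fun f => f (p : MvPolynomial (Fin 2) ℂ)) substitution_one
  map_mul' g h := by
    ext p : 2
    exact congrArg (fun f => f (p : MvPolynomial (Fin 2) ℂ)) (substitution_mul g h)

/-- The heat kernel `δ_t(g) = ∑_{j ∈ ℕ/2} (2j+1) e^{-t j(j+1)} χ_j(g)` on `SU(2)`, written with
`n = 2j`. The characters of `SU(2)` are real-valued; `re` only turns them into real numbers. -/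
def heatKernel (t : ℝ) (g : SU2) : ℝ :=
  ∑' n : ℕ, ((n : ℝ) + 1) * Real.exp (-t * ((n : ℝ) / 2 * ((n : ℝ) / 2 + 1))) *
    ((spinRep n).character g).re

/-! ### Coloured graphs

The four colours are the elements of `Fin 4`. -/

/-- A closed (vacuum) bipartite `4`-coloured graph with white nodes `W` (interaction vertices
`λ`) and black nodes `B` (interaction vertices `λ̄`). Every node carries exactly one line of each
colour, and every line joins a white node to a black one; so the lines of colour `c` are a
bijection `W ≃ B`. Several lines may join the same two nodes. -/
structure ColouredGraph (W B : Type*) where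
  line : Fin 4 → W ≃ B

namespace ColouredGraph

variable {W B : Type*}

/-- `G.Joined c x y`: a line of colour `c` goes from the white node `x` to the black node `y`. -/
def Joined (G : ColouredGraph W B) (c : Fin 4) (x y : W ⊕ B) : Prop :=
  ∃ w : W, x = Sum.inl w ∧ y = Sum.inr (G.line c w)

/-- The underlying simple graph, which only serves to say that `G` is connected. -/
def toSimpleGraph (G : ColouredGraph W B) : SimpleGraph (W ⊕ B) :=
  SimpleGraph.fromRel fun x y => ∃ c, G.Joined c x y

/-- A line of colour `c` is named by its white end; `G.lineAt c n` is the line of colour `c` at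
the node `n`. -/
def lineAt (G : ColouredGraph W B) (c : Fin 4) : W ⊕ B → W
  | Sum.inl w => w
  | Sum.inr b => (G.line c).symm b

end ColouredGraph

/-! ### Regularised amplitudes -/

/-- The cyclic orders in the field arguments and in the interaction. In colours `1,2,3,4` the rows
are `(2,3,4)`, `(4,3,1)`, `(4,1,2)`, `(1,3,2)`. Row `ℓ` lists the vertices of the triangle of colour
`ℓ` in the order of the arguments of `ψ_ℓ`, and it also lists the triangles around the vertex of
colour `ℓ` in the order in which they enter the flatness condition at that vertex. -/
def order : Fin 4 → Fin 3 → Fin 4 :=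
  ![![1, 2, 3], ![3, 2, 0], ![3, 0, 1], ![0, 2, 1]]

/-- The holonomies of a triangle of colour `ℓ`: `x` and `y` at its first and second vertex and
`(x y)⁻¹` at the third. A triangle has no vertex of its own colour; that entry is not used. -/
def triangleHolonomy (l : Fin 4) (p : SU2 × SU2) (v : Fin 4) : SU2 :=
  if v = order l 0 then p.1
  else if v = order l 1 then p.2
  else if v = order l 2 then (p.1 * p.2)⁻¹
  else 1

/-- The covariance of a line of colour `ℓ`: the measure `δ(G₁ G₂ G₃) dG₁ dG₂ dG₃`, where
`G₁, G₂, G₃` are the holonomies of the dual triangle at its three vertices, in order. -/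
def lineMeasure (l : Fin 4) : Measure (Fin 4 → SU2) :=
  (haar.prod haar).map (triangleHolonomy l)

/-- The regularised interaction kernel at one tetrahedron: the product over its four vertices `v`
of `δ_t` of the ordered product of the `G^ℓ_v` around `v`, divided by `δ_t(1)`. Here `G ℓ v` is
the holonomy at the vertex `v` of the triangle of colour `ℓ`. -/
def interaction (t : ℝ) (G : Fin 4 → Fin 4 → SU2) : ℝ :=
  (∏ v : Fin 4,
    heatKernel t (G (order v 0) v * G (order v 1) v * G (order v 2) v)) / heatKernel t 1

/-- The regularised Feynman amplitude of `G`: a factor `(-λ)(-λ̄) = |λ|²` for each pair of a white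
and a black node, the covariance on every line, the interaction kernel at every node. -/
def amplitude {W B : Type*} [Fintype W] [Fintype B] (G : ColouredGraph W B) (lam : ℂ) (t : ℝ) :
    ℝ :=
  Complex.normSq lam ^ Fintype.card W *
    ∫ x : Fin 4 × W → Fin 4 → SU2,
      ∏ n : W ⊕ B, interaction t (fun l v => x (l, G.lineAt l n) v)
      ∂(Measure.pi fun f : Fin 4 × W => lineMeasure f.1)

/-- The amplitude after the rescaling `λ → λ / √δ_t(1)` of the coupling constant. -/
def rescaledAmplitude {W B : Type*} [Fintype W] [Fintype B] (G : ColouredGraph W B) (lam : ℂ)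
    (t : ℝ) : ℝ :=
  amplitude G (lam / (Real.sqrt (heatKernel t 1) : ℂ)) t

/-- The divergence degree `inf {γ ∈ ℝ | lim_{t → 0⁺} δ_t(1)^{-γ} A_t exists and is finite}`, an
extended real. -/
def divergenceDegree (A : ℝ → ℝ) : EReal :=
  sInf ((fun γ : ℝ => (γ : EReal)) ''
    {γ : ℝ | ∃ L : ℝ, Tendsto (fun t : ℝ => heatKernel t 1 ^ (-γ) * A t) (𝓝[>] 0) (𝓝 L)})

/-! ### Jackets -/

/-- The cyclic permutations of the four colours. -/
abbrev ColourCycle : Type :=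
  {τ : Equiv.Perm (Fin 4) // τ.IsCycle ∧ τ.support = Finset.univ}

/-- Identification of a cyclic permutation with its inverse. -/
instance jacketSetoid : Setoid ColourCycle where
  r σ τ := σ.1 = τ.1 ∨ σ.1 = τ.1⁻¹
  iseqv :=
    { refl := fun _ => Or.inl rfl
      symm := by
        rintro σ τ (h | h)
        · exact Or.inl h.symm
        · exact Or.inr (by rw [h, inv_inv])
      trans := by
        rintro σ τ ρ (h | h) (h' | h')
        · exact Or.inl (h.trans h')
        · exact Or.inr (h.trans h')
        · exact Or.inr (by rw [h, h'])
        · exact Or.inl (by rw [h, h', inv_inv]) }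

/-- The labels of jackets: the pairs `(σ, σ⁻¹)` of cyclic permutations of the colours. -/
def Jacket : Type := Quotient jacketSetoid

instance : Finite Jacket := inferInstanceAs (Finite (Quotient jacketSetoid))

instance : Fintype Jacket := Fintype.ofFinite _

section Surface

variable {W B : Type*} (G : ColouredGraph W B) (σ : Equiv.Perm (Fin 4))

/- The jacket of `σ` is obtained from one rectangle in each tetrahedron (node) `n`. Its corner
`(n, c)` is the midpoint of the edge of `n` with end points of colours `c` and `σ c`. Its side
`(n, c)` joins the corners `(n, c)` and `(n, σ c)`; it lies in the triangle with vertices of colours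
`c`, `σ c`, `σ² c`, that is, in the triangle of colour `σ⁻¹ c`. Rectangles are glued along their
sides when these triangles are glued. -/

/-- The sides `p` and `q` are glued. -/
def SideGlue (p q : (W ⊕ B) × Fin 4) : Prop :=
  G.Joined (σ⁻¹ p.2) p.1 q.1 ∧ p.2 = q.2

/-- The corners `p` and `q` are end points, with the same label, of glued sides. -/
def CornerGlue (p q : (W ⊕ B) × Fin 4) : Prop :=
  ∃ c, G.Joined (σ⁻¹ c) p.1 q.1 ∧ p.2 = q.2 ∧ (p.2 = c ∨ p.2 = σ c)

/-- The faces of the jacket: one rectangle for each tetrahedron. -/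
abbrev JacketFace (_G : ColouredGraph W B) (_σ : Equiv.Perm (Fin 4)) : Type _ := W ⊕ B

/-- The edges of the jacket: sides of rectangles up to gluing. -/
def JacketEdge : Type _ := Quot (SideGlue G σ)

/-- The vertices of the jacket: corners of rectangles up to gluing. -/
def JacketVertex : Type _ := Quot (CornerGlue G σ)

/-- The Euler characteristic of the quadrangulated surface. -/
def eulerChar : ℤ :=
  (Nat.card (JacketFace G σ) : ℤ) - Nat.card (JacketEdge G σ) + Nat.card (JacketVertex G σ)

theorem eulerChar_inv (h4 : ∀ c, σ (σ (σ (σ c))) = c) : eulerChar G σ⁻¹ = eulerChar G σ := by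
  have h3 : ∀ c, σ⁻¹ c = σ (σ (σ c)) := fun c => by
    rw [Equiv.Perm.inv_eq_iff_eq, h4]
  have hinj : Function.Injective σ := σ.injective
  have e : Nat.card (JacketEdge G σ) = Nat.card (JacketEdge G σ⁻¹) := by
    refine Nat.card_congr (Quot.congr (Equiv.prodCongr (Equiv.refl _) (σ * σ)) ?_)
    rintro ⟨x, c⟩ ⟨y, d⟩
    simp [SideGlue, h3]
  have v : Nat.card (JacketVertex G σ) = Nat.card (JacketVertex G σ⁻¹) := by
    refine Nat.card_congr (Quot.congr (Equiv.prodCongr (Equiv.refl _) σ) ?_)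
    rintro ⟨x, c⟩ ⟨y, d⟩
    constructor
    · rintro ⟨k, h1, h2, h5⟩
      refine ⟨σ (σ k), ?_, ?_, ?_⟩
      · simpa [h3] using h1
      · simpa using h2
      · rcases h5 with h5 | h5 <;> simp at h5 <;> simp [h5]
    · rintro ⟨k, h1, h2, h5⟩
      refine ⟨σ (σ k), ?_, ?_, ?_⟩
      · simpa [h3, h4] using h1
      · simpa using h2
      · rcases h5 with h5 | h5
        · right
          apply hinj
          simpa [h4] using h5
        · left
          apply hinj
          simpa [h3] using h5
  simp only [eulerChar, JacketFace, e, v]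

end Surface

theorem iterate_four (σ : Equiv.Perm (Fin 4)) (h1 : σ.IsCycle) (h2 : σ.support = Finset.univ)
    (c : Fin 4) : σ (σ (σ (σ c))) = c := by
  have h : orderOf σ = 4 := by
    rw [h1.orderOf, h2]
    rfl
  have h' := pow_orderOf_eq_one σ
  rw [h] at h'
  simpa [pow_succ] using congrArg (fun τ : Equiv.Perm (Fin 4) => τ c) h'

/-- The genus `g_J` of the jacket `J`, defined by `2 - 2 g_J = χ_J`. (For connected `G` the jacket
is a connected closed orientable surface.) -/
def genus {W B : Type*} (G : ColouredGraph W B) (J : Jacket) : ℝ :=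
  Quotient.lift (fun σ : ColourCycle => (2 - (eulerChar G σ.1 : ℝ)) / 2)
    (by
      rintro σ τ (h | h)
      · simp only [h]
      · simp only [h, eulerChar_inv G τ.1 (iterate_four τ.1 τ.2.1 τ.2.2)]) J

end Boulatov

end

/-! The amplitude of a graph is an integral, over one pair of elements of `SU(2)` per line, of a
product of heat kernels `δ_t`, four at each node; it has to be compared with powers of
`δ_t(1) ≍ t^{-3/2}`.

**The heat kernel.** Multiplication by `2 - χ_{1/2}` takes the second difference of the character
coefficients of a central function (`two_sub_reTrace_mul_tsum`). Doing this twice and estimating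
the fourth derivative of `x e^{-t(x²-1)/4}` gives the pointwise bound
`|δ_t(g)| ≤ C t^{-3/2} (1 + d(g)²/t)⁻²` (`abs_heatKernel_le_weight`), where `d(g) = √(2 - tr g)`
is the bi-invariant distance of `g` to the identity. The weight `(1 + d²/t)⁻²` has Haar integral
of order `t^{3/2}` (`lintegral_weight_le`), because a ball of radius `ρ` has Haar measure of order
at most `ρ³`.

**The octahedron in a tetrahedron.** Pair the four colours, say `0 ↔ 2` and `1 ↔ 3`. The midpoints
of the edges of a tetrahedron span an octahedron, and the rectangle that separates the edges
`(0, 2)` and `(1, 3)` cuts it into two halves, one facing the vertices `0`, `2` and one facing the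
vertices `1`, `3`. The holonomy around the rectangle is, up to conjugation and inversion, a
product of conjugates of the two vertex holonomies of either half. So the triangle inequality lets
one trade, in each half, one of the two vertex weights for the weight of the rectangle
(`weight_mul_weight_le`). Dropping one of the two copies of the latter leaves three bounded
factors at each node: two that are sums of vertex weights, and the weight of the rectangle
(`prod_weight_vertexWord_le`).

**Integration.** A factor is integrated with a variable on which it depends and on which no other
remaining factor does (`lintegral_prod_le_of_elimination`). The variable `g` of a line enters the
factors of one of the two halves only, at the two ends of the line; the variable `s` also enters
the rectangles. Therefore the factors of a half are removed along the lines of two colours, and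
afterwards the rectangles along all lines; in each component of the corresponding subgraph all
factors but one are integrated. If `F` and `F'` are the numbers of faces with the two colours of
either pair, the graph being connected, this yields `|∫| ≤ C δ_t(1)^(F + F' + 1)`, and after the
rescaling of the coupling `γ ≤ 1 + F + F' - |W|` (`divergenceDegree_le_pairingExponent`).

**Jackets.** The vertices of the jacket of `σ` are the faces with colours `c, σ c`, so they belong
to two of the three pairings, and `χ = (F₁ + F₁') + (F₂ + F₂') - 2|W|` (`eulerChar_eq`). The
better of the two bounds is at most their mean, which is `1 + χ / 2 = 2 - g`. Finally there are
exactly three jackets (`card_jacket`), so that the supremum of the genera is at least a third of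
their sum. -/

open scoped ENNReal

noncomputable section

namespace Boulatov

/-! ### The characters of `SU(2)` -/

theorem trace_eq_sum_of_basis_eigenvectors {ι M : Type*} [Fintype ι] [AddCommGroup M] [Module ℂ M]
    (b : Module.Basis ι ℂ M) (f : M →ₗ[ℂ] M) (c : ι → ℂ) (h : ∀ i, f (b i) = c i • b i) :
    LinearMap.trace ℂ M f = ∑ i, c i := by
  classical
  rw [LinearMap.trace_eq_matrix_trace ℂ b, Matrix.trace]
  refine Finset.sum_congr rfl fun i _ => ?_
  simp [LinearMap.toMatrix_apply, h]

/-- The monomials `X₀ ^ p X₁ ^ q` of degree `n`, indexed by the pairs with `p + q = n`. -/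
def monomialBasis (n : ℕ) : Module.Basis (Finset.HasAntidiagonal.antidiagonal n) ℂ
    (MvPolynomial.homogeneousSubmodule (Fin 2) ℂ n) :=
  ((MvPolynomial.basisRestrictSupport ℂ {d : Fin 2 →₀ ℕ | d.degree = n}).map
    (LinearEquiv.ofEq _ _
      (MvPolynomial.homogeneousSubmodule_eq_finsupp_supported (Fin 2) ℂ n).symm)).reindex
    { toFun := fun d => ⟨(d.1 0, d.1 1), by
        have h := d.2
        simpa [Finsupp.degree_eq_sum, Fin.sum_univ_two] using h⟩
      invFun := fun p => ⟨Finsupp.equivFunOnFinite.symm ![p.1.1, p.1.2], by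
        have h := Finset.HasAntidiagonal.mem_antidiagonal.1 p.2
        simpa [Finsupp.degree_eq_sum, Fin.sum_univ_two] using h⟩
      left_inv := fun d => by
        ext i
        fin_cases i <;> rfl
      right_inv := fun p => rfl }

theorem basisRestrictSupport_apply (s : Set (Fin 2 →₀ ℕ)) (d : s) :
    (MvPolynomial.basisRestrictSupport ℂ s d : MvPolynomial (Fin 2) ℂ) =
      MvPolynomial.monomial (d : Fin 2 →₀ ℕ) 1 := by
  classical
  have hmem : MvPolynomial.monomial (d : Fin 2 →₀ ℕ) (1 : ℂ) ∈
      MvPolynomial.restrictSupport ℂ s := by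
    rw [MvPolynomial.restrictSupport_eq_span]
    exact Submodule.subset_span ⟨d, d.2, rfl⟩
  have h : MvPolynomial.basisRestrictSupport ℂ s d =
      ⟨MvPolynomial.monomial (d : Fin 2 →₀ ℕ) (1 : ℂ), hmem⟩ := by
    rw [Module.Basis.apply_eq_iff]
    ext e
    change MvPolynomial.coeff (e : Fin 2 →₀ ℕ) (MvPolynomial.monomial (d : Fin 2 →₀ ℕ) (1 : ℂ)) = _
    rw [MvPolynomial.coeff_monomial, Finsupp.single_apply]
    simp only [Subtype.ext_iff]
  rw [h]

theorem monomialBasis_apply (n : ℕ) (p : Finset.HasAntidiagonal.antidiagonal n) :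
    (monomialBasis n p : MvPolynomial (Fin 2) ℂ) =
      MvPolynomial.X 0 ^ p.1.1 * MvPolynomial.X 1 ^ p.1.2 := by
  have : (monomialBasis n p : MvPolynomial (Fin 2) ℂ) =
      MvPolynomial.monomial (Finsupp.equivFunOnFinite.symm ![p.1.1, p.1.2]) 1 := by
    simp only [monomialBasis, Module.Basis.reindex_apply, Module.Basis.map_apply]
    exact basisRestrictSupport_apply _ _
  rw [this, MvPolynomial.monomial_eq]
  simp [Finsupp.prod_fintype]

theorem character_of_diagonal (n : ℕ) (d : SU2) (z w : ℂ)
    (hd : (d : Matrix (Fin 2) (Fin 2) ℂ) = Matrix.diagonal ![z, w]) :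
    (spinRep n).character d = ∑ p ∈ Finset.HasAntidiagonal.antidiagonal n, z ^ p.1 * w ^ p.2 := by
  rw [← Finset.sum_coe_sort]
  refine trace_eq_sum_of_basis_eigenvectors (monomialBasis n) _
    (fun p => z ^ p.1.1 * w ^ p.1.2) fun p => ?_
  apply Subtype.ext
  change substitution d (monomialBasis n p : MvPolynomial (Fin 2) ℂ) =
    (z ^ p.1.1 * w ^ p.1.2) • (monomialBasis n p : MvPolynomial (Fin 2) ℂ)
  rw [monomialBasis_apply]
  simp only [substitution, hd, map_mul, map_pow, MvPolynomial.aeval_X, Fin.sum_univ_two]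
  simp [MvPolynomial.smul_eq_C_mul, mul_pow]
  ring

theorem sum_antidiagonal_pow_recurrence (z w : ℂ) (n : ℕ) :
    ∑ p ∈ Finset.HasAntidiagonal.antidiagonal (n + 2), z ^ p.1 * w ^ p.2 =
      (z + w) * ∑ p ∈ Finset.HasAntidiagonal.antidiagonal (n + 1), z ^ p.1 * w ^ p.2 -
        z * w * ∑ p ∈ Finset.HasAntidiagonal.antidiagonal n, z ^ p.1 * w ^ p.2 := by
  have h1 : ∀ m : ℕ, ∑ p ∈ Finset.HasAntidiagonal.antidiagonal (m + 1), z ^ p.1 * w ^ p.2 =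
      w ^ (m + 1) + z * ∑ p ∈ Finset.HasAntidiagonal.antidiagonal m, z ^ p.1 * w ^ p.2 := by
    intro m
    rw [Finset.Nat.sum_antidiagonal_succ, Finset.mul_sum]
    simp [pow_succ, mul_assoc, mul_comm]
  have h2 := h1 n
  rw [h1 (n + 1), h2]
  ring

/-- Elements of `SU(2)` are diagonalisable within `SU(2)`. -/
theorem exists_diagonalisation (g : SU2) : ∃ h d : SU2, ∃ z w : ℂ, g = h * d * h⁻¹ ∧
    (d : Matrix (Fin 2) (Fin 2) ℂ) = Matrix.diagonal ![z, w] := by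
  obtain ⟨z, hz⟩ := Module.End.exists_eigenvalue (Matrix.toLin' (g : Matrix (Fin 2) (Fin 2) ℂ))
  obtain ⟨v, hv⟩ := hz.exists_hasEigenvector
  have hv1 : (g : Matrix (Fin 2) (Fin 2) ℂ).mulVec v = z • v := by
    simpa using hv.apply_eq_smul
  have hv0 : v ≠ 0 := hv.2
  have hpos : 0 < Complex.normSq (v 0) + Complex.normSq (v 1) := by
    by_contra hcon
    apply hv0
    have a := Complex.normSq_nonneg (v 0)
    have b := Complex.normSq_nonneg (v 1)
    have h0 : v 0 = 0 := Complex.normSq_eq_zero.1 (by linarith)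
    have h1 : v 1 = 0 := Complex.normSq_eq_zero.1 (by linarith)
    ext i
    fin_cases i
    · exact h0
    · exact h1
  set r : ℝ := Real.sqrt (Complex.normSq (v 0) + Complex.normSq (v 1)) with hr
  have hr2 : r * r = Complex.normSq (v 0) + Complex.normSq (v 1) :=
    Real.mul_self_sqrt hpos.le
  have hr0 : (r : ℂ) ≠ 0 := by
    exact_mod_cast (Real.sqrt_pos.2 hpos).ne'
  have hrC : (r : ℂ) * r = v 0 * star (v 0) + v 1 * star (v 1) := by
    rw [← Complex.ofReal_mul, hr2]
    simp [Complex.mul_conj]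
  -- the unit eigenvector `(a, b)` is completed to a matrix of determinant one
  obtain ⟨a, ha⟩ : ∃ a : ℂ, a = v 0 / r := ⟨_, rfl⟩
  obtain ⟨b, hb⟩ : ∃ b : ℂ, b = v 1 / r := ⟨_, rfl⟩
  have hab : a * star a + b * star b = 1 := by
    have : star (r : ℂ) = r := Complex.conj_ofReal r
    simp only [ha, hb, star_div₀, this]
    field_simp
    rw [pow_two, hrC]
  have hU : (!![a, -star b; b, star a] : Matrix (Fin 2) (Fin 2) ℂ) ∈
      Matrix.specialUnitaryGroup (Fin 2) ℂ := by
    rw [Matrix.mem_specialUnitaryGroup_iff, Matrix.mem_unitaryGroup_iff]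
    constructor
    · ext i j
      fin_cases i <;> fin_cases j <;>
        simp [Matrix.mul_apply, Fin.sum_univ_two, Matrix.star_apply] at hab ⊢ <;>
        first | ring1 | linear_combination hab
    · rw [Matrix.det_fin_two_of]
      linear_combination hab
  let h : SU2 := ⟨_, hU⟩
  have hg : (g : Matrix (Fin 2) (Fin 2) ℂ).mulVec ![a, b] = z • ![a, b] := by
    have : (![a, b] : Fin 2 → ℂ) = (r : ℂ)⁻¹ • v := by
      ext i
      fin_cases i <;> simp [ha, hb, div_eq_inv_mul]
    rw [this, Matrix.mulVec_smul, hv1, smul_comm]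
  have h0 := congrFun hg 0
  have h1 := congrFun hg 1
  simp [Matrix.mulVec, dotProduct, Fin.sum_univ_two] at h0 h1
  -- `h⁻¹ * g * h` is upper triangular; being unitary it is diagonal
  let d : SU2 := h⁻¹ * g * h
  have hinv : ((h⁻¹ : SU2) : Matrix (Fin 2) (Fin 2) ℂ) = !![star a, star b; -b, a] := by
    change star (!![a, -star b; b, star a] : Matrix (Fin 2) (Fin 2) ℂ) = _
    ext i j
    fin_cases i <;> fin_cases j <;> simp [Matrix.star_apply]
  have hdm : (d : Matrix (Fin 2) (Fin 2) ℂ) =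
      !![star a, star b; -b, a] * (g : Matrix (Fin 2) (Fin 2) ℂ) * !![a, -star b; b, star a] := by
    rw [← hinv]
    rfl
  have d10 : (d : Matrix (Fin 2) (Fin 2) ℂ) 1 0 = 0 := by
    rw [hdm, mul_assoc]
    simp [Matrix.mul_apply, Fin.sum_univ_two]
    linear_combination (-b) * h0 + a * h1
  have d00 : (d : Matrix (Fin 2) (Fin 2) ℂ) 0 0 = z := by
    rw [hdm, mul_assoc]
    simp [Matrix.mul_apply, Fin.sum_univ_two]
    simp at hab
    linear_combination (starRingEnd ℂ a) * h0 + (starRingEnd ℂ b) * h1 + z * hab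
  have hdu := (Matrix.mem_unitaryGroup_iff'.1 (Matrix.mem_specialUnitaryGroup_iff.1 d.2).1)
  have hdet := (Matrix.mem_specialUnitaryGroup_iff.1 d.2).2
  have e00 := congrFun (congrFun hdu 0) 0
  have e01 := congrFun (congrFun hdu 0) 1
  simp [Matrix.mul_apply, Fin.sum_univ_two, Matrix.star_apply, d10] at e00 e01
  have hz0 : (starRingEnd ℂ) ((d : Matrix (Fin 2) (Fin 2) ℂ) 0 0) ≠ 0 := by
    intro hc
    simp [hc] at e00
  have d01 : (d : Matrix (Fin 2) (Fin 2) ℂ) 0 1 = 0 := by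
    rcases e01 with e01 | e01
    · simp [e01] at hz0
    · exact e01
  refine ⟨h, d, z, (d : Matrix (Fin 2) (Fin 2) ℂ) 1 1, ?_, ?_⟩
  · simp [d, mul_assoc]
  · ext i j
    fin_cases i <;> fin_cases j <;> simp [d10, d01, d00]

/-- The trace of an element of `SU(2)`, which is real, as a real number. -/
def reTrace (g : SU2) : ℝ := (Matrix.trace (g : Matrix (Fin 2) (Fin 2) ℂ)).re

theorem coe_inv (g : SU2) : ((g⁻¹ : SU2) : Matrix (Fin 2) (Fin 2) ℂ) =
    star (g : Matrix (Fin 2) (Fin 2) ℂ) := rfl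

theorem adjugate_eq_star (g : SU2) : Matrix.adjugate (g : Matrix (Fin 2) (Fin 2) ℂ) =
    star (g : Matrix (Fin 2) (Fin 2) ℂ) := by
  have h1 := Matrix.mem_unitaryGroup_iff.1 (Matrix.mem_specialUnitaryGroup_iff.1 g.2).1
  have h2 := Matrix.adjugate_mul (g : Matrix (Fin 2) (Fin 2) ℂ)
  rw [(Matrix.mem_specialUnitaryGroup_iff.1 g.2).2, one_smul] at h2
  calc Matrix.adjugate (g : Matrix (Fin 2) (Fin 2) ℂ)
      = Matrix.adjugate (g : Matrix (Fin 2) (Fin 2) ℂ) *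
          ((g : Matrix (Fin 2) (Fin 2) ℂ) * star (g : Matrix (Fin 2) (Fin 2) ℂ)) := by
        rw [h1, mul_one]
    _ = _ := by rw [← mul_assoc, h2, one_mul]

theorem coe_one_one (g : SU2) : (g : Matrix (Fin 2) (Fin 2) ℂ) 1 1 =
    star ((g : Matrix (Fin 2) (Fin 2) ℂ) 0 0) := by
  have := congrFun (congrFun (adjugate_eq_star g) 0) 0
  simpa [Matrix.adjugate_fin_two, Matrix.star_apply] using this

theorem coe_one_zero (g : SU2) : (g : Matrix (Fin 2) (Fin 2) ℂ) 1 0 =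
    -star ((g : Matrix (Fin 2) (Fin 2) ℂ) 0 1) := by
  have := congrFun (congrFun (adjugate_eq_star g) 1) 0
  simp [Matrix.adjugate_fin_two, Matrix.star_apply] at this ⊢
  rw [← this, neg_neg]

theorem trace_eq_reTrace (g : SU2) :
    Matrix.trace (g : Matrix (Fin 2) (Fin 2) ℂ) = (reTrace g : ℂ) := by
  apply Complex.ext
  · simp [reTrace]
  · simp [Matrix.trace_fin_two, coe_one_one]

/-- The Clebsch–Gordan rule `χ_{1/2} χ_{j+1/2} = χ_{j+1} + χ_j`, with `n = 2j`. -/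
theorem character_recurrence (g : SU2) (n : ℕ) :
    (spinRep (n + 2)).character g =
      reTrace g * (spinRep (n + 1)).character g - (spinRep n).character g := by
  obtain ⟨h, d, z, w, rfl, hd⟩ := exists_diagonalisation g
  have hdet := (Matrix.mem_specialUnitaryGroup_iff.1 d.2).2
  rw [hd, Matrix.det_diagonal, Fin.prod_univ_two] at hdet
  have htr : (reTrace (h * d * h⁻¹) : ℂ) = z + w := by
    rw [← trace_eq_reTrace, Submonoid.coe_mul, Matrix.trace_mul_comm, ← Submonoid.coe_mul,
      inv_mul_cancel_left, hd, Matrix.trace_diagonal, Fin.sum_univ_two]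
    rfl
  have hconj : ∀ m, (spinRep m).character (h * d * h⁻¹) = (spinRep m).character d := fun m => by
    rw [Representation.char_mul_comm, inv_mul_cancel_left]
  simp only [hconj, htr, character_of_diagonal _ d z w hd, sum_antidiagonal_pow_recurrence]
  simp at hdet
  rw [hdet, one_mul]

/-- The real character of spin `n / 2`. -/
def chi (n : ℕ) (g : SU2) : ℝ := ((spinRep n).character g).re

theorem chi_zero (g : SU2) : chi 0 g = 1 := by
  obtain ⟨h, d, z, w, rfl, hd⟩ := exists_diagonalisation g
  rw [chi, Representation.char_mul_comm, inv_mul_cancel_left, character_of_diagonal _ d z w hd]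
  simp

theorem chi_one (g : SU2) : chi 1 g = reTrace g := by
  obtain ⟨h, d, z, w, rfl, hd⟩ := exists_diagonalisation g
  rw [chi, Representation.char_mul_comm, inv_mul_cancel_left, character_of_diagonal _ d z w hd,
    reTrace, Submonoid.coe_mul, Matrix.trace_mul_comm, ← Submonoid.coe_mul,
      inv_mul_cancel_left, hd, Matrix.trace_diagonal, Fin.sum_univ_two]
  simp [Finset.HasAntidiagonal.antidiagonal]
  ring

theorem chi_recurrence (g : SU2) (n : ℕ) :
    chi (n + 2) g = reTrace g * chi (n + 1) g - chi n g := by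
  simp [chi, character_recurrence]

theorem abs_chi_le (g : SU2) (n : ℕ) : |chi n g| ≤ n + 1 := by
  obtain ⟨h, d, z, w, rfl, hd⟩ := exists_diagonalisation g
  have hu := (Matrix.mem_specialUnitaryGroup_iff.1 d.2).1
  have hz : ‖z‖ ≤ 1 := by
    have := entry_norm_bound_of_unitary hu 0 0
    simpa [hd] using this
  have hw : ‖w‖ ≤ 1 := by
    have := entry_norm_bound_of_unitary hu 1 1
    simpa [hd] using this
  rw [chi, Representation.char_mul_comm, inv_mul_cancel_left, character_of_diagonal _ d z w hd]
  refine (Complex.abs_re_le_norm _).trans ((norm_sum_le _ _).trans ?_)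
  have : ∀ p ∈ Finset.HasAntidiagonal.antidiagonal n, ‖z ^ p.1 * w ^ p.2‖ ≤ 1 := fun p _ => by
    rw [norm_mul, norm_pow, norm_pow]
    exact mul_le_one₀ (pow_le_one₀ (norm_nonneg _) hz) (by positivity)
      (pow_le_one₀ (norm_nonneg _) hw)
  refine (Finset.sum_le_sum this).trans ?_
  simp

theorem reTrace_one : reTrace 1 = 2 := by
  simp [reTrace]

theorem chi_at_one (n : ℕ) : chi n 1 = n + 1 := by
  induction n using Nat.strong_induction_on with
  | _ n ih =>
    match n with
    | 0 => simp [chi_zero]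
    | 1 => norm_num [chi_one, reTrace_one]
    | m + 2 =>
      rw [chi_recurrence, ih (m + 1) (by omega), ih m (by omega), reTrace_one]
      push_cast
      ring

theorem abs_reTrace_le (g : SU2) : |reTrace g| ≤ 2 := by
  have := abs_chi_le g 1
  rw [chi_one] at this
  norm_num at this
  exact this

/-! ### Second differences and summation by parts -/

/-- The negative of the second difference of `f` with unit step. -/
def secondDiff (f : ℝ → ℝ) (x : ℝ) : ℝ := 2 * f x - f (x - 1) - f (x + 1)

theorem abs_secondDiff_le {f f' f'' : ℝ → ℝ} (hf : ∀ x, HasDerivAt f (f' x) x)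
    (hf' : ∀ x, HasDerivAt f' (f'' x) x) {x M : ℝ}
    (hM : ∀ y, |y - x| ≤ 1 → |f'' y| ≤ M) : |secondDiff f x| ≤ 2 * M := by
  have h1 : ∀ y ∈ Set.Icc (0 : ℝ) 1, ‖f' (x + y) - f' (x - y)‖ ≤ 2 * M := by
    intro y hy
    have := (convex_Icc (x - 1) (x + 1)).norm_image_sub_le_of_norm_hasDerivWithin_le
      (f := f') (f' := f'') (C := M) (x := x - y) (y := x + y)
      (fun z _ => (hf' z).hasDerivWithinAt)
      (fun z hz => hM z (abs_le.2 ⟨by linarith [hz.1], by linarith [hz.2]⟩))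
      ⟨by linarith [hy.2], by linarith [hy.1]⟩ ⟨by linarith [hy.1], by linarith [hy.2]⟩
    refine this.trans ?_
    have hM0 : 0 ≤ M := (abs_nonneg _).trans (hM x (by simp))
    rw [Real.norm_eq_abs, abs_of_nonneg (by linarith [hy.1])]
    nlinarith [hy.1, hy.2]
  have h2 : ∀ y, HasDerivAt (fun y => f (x + y) + f (x - y)) (f' (x + y) - f' (x - y)) y := by
    intro y
    have a := (hf (x + y)).comp_const_add x y
    have b := (hf (x - y)).comp_const_sub x y
    exact (a.add b).congr_deriv (by ring)
  have := (convex_Icc (0 : ℝ) 1).norm_image_sub_le_of_norm_hasDerivWithin_le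
    (fun z _ => (h2 z).hasDerivWithinAt) h1 (Set.left_mem_Icc.2 zero_le_one)
    (Set.right_mem_Icc.2 zero_le_one)
  simp only [Real.norm_eq_abs, add_zero, sub_zero, abs_one, mul_one] at this
  rw [secondDiff, ← abs_neg]
  convert! this using 2
  ring

theorem hasDerivAt_secondDiff {f f' : ℝ → ℝ} (hf : ∀ x, HasDerivAt f (f' x) x) (x : ℝ) :
    HasDerivAt (secondDiff f) (secondDiff f' x) x :=
  (((hf x).const_mul 2).sub ((hf (x - 1)).comp_sub_const x 1)).sub
    ((hf (x + 1)).comp_add_const x 1)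

theorem abs_secondDiff_secondDiff_le {f f1 f2 f3 f4 : ℝ → ℝ} (h0 : ∀ x, HasDerivAt f (f1 x) x)
    (h1 : ∀ x, HasDerivAt f1 (f2 x) x) (h2 : ∀ x, HasDerivAt f2 (f3 x) x)
    (h3 : ∀ x, HasDerivAt f3 (f4 x) x) {x M : ℝ}
    (hM : ∀ y, |y - x| ≤ 2 → |f4 y| ≤ M) : |secondDiff (secondDiff f) x| ≤ 4 * M := by
  have := abs_secondDiff_le (hasDerivAt_secondDiff h0) (hasDerivAt_secondDiff h1) (x := x)
    (M := 2 * M) fun y hy => abs_secondDiff_le h2 h3 fun z hz => hM z (by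
      calc |z - x| ≤ |z - y| + |y - x| := abs_sub_le z y x
        _ ≤ 2 := by linarith)
  linarith

theorem summable_mul_chi {β : ℕ → ℝ} (h : Summable fun n : ℕ => ((n : ℝ) + 1) * |β n|) (g : SU2) :
    Summable fun n => β n * chi n g := by
  refine h.of_norm_bounded fun n => ?_
  rw [Real.norm_eq_abs, abs_mul, mul_comm]
  exact mul_le_mul_of_nonneg_right (abs_chi_le g n) (abs_nonneg _)

theorem summable_shift {β : ℝ → ℝ} (h : Summable fun n : ℕ => ((n : ℝ) + 1) * |β n|) :
    Summable fun n : ℕ => ((n : ℝ) + 1) * |β (n + 1)| := by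
  refine ((summable_nat_add_iff 1).2 h).of_nonneg_of_le (fun n => by positivity) fun n => ?_
  push_cast
  exact mul_le_mul_of_nonneg_right (by linarith) (abs_nonneg _)

theorem summable_secondDiff {β : ℝ → ℝ} (h : Summable fun n : ℕ => ((n : ℝ) + 1) * |β n|) :
    Summable fun n : ℕ => ((n : ℝ) + 1) * |secondDiff β n| := by
  have h1 := summable_shift h
  have h2 : Summable fun n : ℕ => ((n : ℝ) + 1) * |β (n - 1)| := by
    rw [← summable_nat_add_iff 1]
    refine (h.mul_left 2).of_nonneg_of_le (fun n => by positivity) fun n => ?_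
    push_cast
    rw [add_sub_cancel_right, ← mul_assoc]
    exact mul_le_mul_of_nonneg_right (by linarith [Nat.cast_nonneg (α := ℝ) n]) (abs_nonneg _)
  refine (((h.mul_left 2).add h2).add h1).of_nonneg_of_le (fun n => by positivity) fun n => ?_
  have : |secondDiff β n| ≤ 2 * |β n| + |β (n - 1)| + |β (n + 1)| := by
    unfold secondDiff
    refine (abs_sub _ _).trans (add_le_add_left ((abs_sub _ _).trans ?_) _)
    rw [abs_mul, abs_two]
  calc ((n : ℝ) + 1) * |secondDiff β n|
      ≤ ((n : ℝ) + 1) * (2 * |β n| + |β (n - 1)| + |β (n + 1)|) := by gcongr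
    _ = _ := by ring

/-- Multiplying a central function by `2 - χ_{1/2}` takes the second difference of its character
coefficients, because `χ_{1/2} χ_j = χ_{j+1/2} + χ_{j-1/2}`. -/
theorem two_sub_reTrace_mul_tsum {β : ℝ → ℝ} (h0 : β 0 = 0)
    (h : Summable fun n : ℕ => ((n : ℝ) + 1) * |β n|) (g : SU2) :
    (2 - reTrace g) * ∑' n : ℕ, β (n + 1) * chi n g =
      ∑' n : ℕ, secondDiff β (n + 1) * chi n g := by
  have h1 := summable_shift h
  have h2 : Summable fun n : ℕ => ((n : ℝ) + 1) * |β (n + 1 + 1)| := by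
    have := summable_shift (β := fun x => β (x + 1)) h1
    exact this
  have s0 := summable_mul_chi (β := fun n => β n) h g
  have s1 := summable_mul_chi (β := fun n => β (n + 1)) h1 g
  have s2 := summable_mul_chi (β := fun n => β (n + 1 + 1)) h2 g
  -- the sums with the character shifted by one step up or down
  have e0 : ∑' n : ℕ, β n * chi n g = ∑' n : ℕ, β (n + 1) * chi (n + 1) g := by
    rw [s0.tsum_eq_zero_add]
    simp [h0]
  have e2 : ∀ n : ℕ, β (n + 1) * ((2 - reTrace g) * chi n g) =
      2 * (β (n + 1) * chi n g) - β (n + 1) * chi (n + 1) g -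
        (match n with
          | 0 => 0
          | m + 1 => β (m + 1 + 1) * chi m g) := by
    intro n
    match n with
    | 0 =>
      simp only [zero_add, chi_zero, chi_one]
      ring
    | m + 1 =>
      simp only [chi_recurrence]
      push_cast
      ring
  have s0' : Summable fun n : ℕ => β (n + 1) * chi (n + 1) g := by
    have := (summable_nat_add_iff 1).2 s0
    simpa using this
  have s2' : Summable fun n : ℕ => (match n with
          | 0 => 0
          | m + 1 => β (m + 1 + 1) * chi m g : ℝ) := by
    rw [← summable_nat_add_iff 1]
    exact s2
  have e3 : ∑' n : ℕ, (match n with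
          | 0 => 0
          | m + 1 => β (m + 1 + 1) * chi m g : ℝ) = ∑' n : ℕ, β (n + 1 + 1) * chi n g := by
    rw [s2'.tsum_eq_zero_add]
    simp
  rw [← tsum_mul_left]
  calc ∑' n : ℕ, (2 - reTrace g) * (β (n + 1) * chi n g)
      = ∑' n : ℕ, (2 * (β (n + 1) * chi n g) - β (n + 1) * chi (n + 1) g -
        (match n with
          | 0 => 0
          | m + 1 => β (m + 1 + 1) * chi m g)) := by
        refine tsum_congr fun n => ?_
        rw [← e2]
        ring
    _ = 2 * ∑' n : ℕ, β (n + 1) * chi n g - ∑' n : ℕ, β n * chi n g -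
          ∑' n : ℕ, β (n + 1 + 1) * chi n g := by
        rw [((s1.mul_left 2).sub s0').tsum_sub s2', (s1.mul_left 2).tsum_sub s0', e3, e0,
          tsum_mul_left]
    _ = ∑' n : ℕ, (2 * (β (n + 1) * chi n g) - β n * chi n g - β (n + 1 + 1) * chi n g) := by
        rw [((s1.mul_left 2).sub s0).tsum_sub s2, (s1.mul_left 2).tsum_sub s0, tsum_mul_left]
    _ = _ := by
        refine tsum_congr fun n => ?_
        rw [secondDiff, add_sub_cancel_right]
        ring

/-! ### Upper and lower bounds on the heat kernel -/

/-- The coefficient of the character of dimension `x` in the heat kernel at time `s ^ 2`, as a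
function of a real variable. -/
def heatCoeff (s x : ℝ) : ℝ := x * Real.exp (-s ^ 2 * (x ^ 2 - 1) / 4)

theorem heatKernel_eq (s : ℝ) (g : SU2) :
    heatKernel (s ^ 2) g = ∑' n : ℕ, heatCoeff s (n + 1) * chi n g := by
  refine tsum_congr fun n => ?_
  rw [heatCoeff, chi]
  congr 3
  ring

theorem exp_neg_mul_pow_le (y : ℝ) : Real.exp (-y ^ 2 / 4) * (1 + y ^ 2) ^ 5 ≤ 20 ^ 5 := by
  have h : (1 + y ^ 2) / 20 ≤ Real.exp (y ^ 2 / 20) := by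
    have := Real.add_one_le_exp (y ^ 2 / 20)
    linarith
  have h5 : Real.exp (y ^ 2 / 20) ^ 5 = Real.exp (y ^ 2 / 4) := by
    rw [← Real.exp_nat_mul]
    congr 1
    push_cast
    ring
  have h6 := pow_le_pow_left₀ (by positivity) h 5
  rw [h5, div_pow, div_le_iff₀ (by norm_num)] at h6
  rw [neg_div, Real.exp_neg, inv_mul_le_iff₀ (Real.exp_pos _)]
  linarith

/-- The Gaussian factor is bounded by an inverse power, uniformly in `s ≤ 1`; the fifth power leaves
enough decay after the polynomial factors below are absorbed. -/
theorem exp_heat_le {s : ℝ} (hs : 0 < s) (hs1 : s ≤ 1) (x : ℝ) :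
    Real.exp (-s ^ 2 * (x ^ 2 - 1) / 4) ≤ 3 * 20 ^ 5 / (1 + (s * x) ^ 2) ^ 5 := by
  rw [le_div_iff₀ (by positivity)]
  have h1 : Real.exp (s ^ 2 / 4) ≤ 3 := by
    refine (Real.exp_le_exp.2 (?_ : s ^ 2 / 4 ≤ 1)).trans Real.exp_one_lt_three.le
    nlinarith
  calc Real.exp (-s ^ 2 * (x ^ 2 - 1) / 4) * (1 + (s * x) ^ 2) ^ 5
      = Real.exp (s ^ 2 / 4) * (Real.exp (-(s * x) ^ 2 / 4) * (1 + (s * x) ^ 2) ^ 5) := by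
        rw [← mul_assoc, ← Real.exp_add]
        congr 2
        ring
    _ ≤ 3 * 20 ^ 5 := by
        gcongr
        exact exp_neg_mul_pow_le _

theorem summable_and_tsum_telescope_le {s : ℝ} (hs : 0 < s) :
    Summable (fun n : ℕ => ((n : ℝ) + 1) / (1 + (s * (n + 1)) ^ 2) ^ 2) ∧
      ∑' n : ℕ, ((n : ℝ) + 1) / (1 + (s * (n + 1)) ^ 2) ^ 2 ≤ 1 / s ^ 2 := by
  have key : ∀ N : ℕ, ∑ n ∈ Finset.range N, ((n : ℝ) + 1) / (1 + (s * (n + 1)) ^ 2) ^ 2 ≤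
      1 / s ^ 2 := by
    intro N
    -- from `n - 1` to `n`, the value of `1 / (1 + s² n²)` drops by at least `s² n / (1 + s² n²)²`
    have step : ∀ n : ℕ, ((n : ℝ) + 1) / (1 + (s * (n + 1)) ^ 2) ^ 2 ≤
        1 / s ^ 2 * (1 / (1 + (s * n) ^ 2)) -
          1 / s ^ 2 * (1 / (1 + (s * ((n + 1 : ℕ) : ℝ)) ^ 2)) := by
      intro n
      have hn : (0 : ℝ) ≤ n := Nat.cast_nonneg n
      push_cast
      set A := 1 + (s * (n : ℝ)) ^ 2 with hA
      set B := 1 + (s * ((n : ℝ) + 1)) ^ 2 with hB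
      have hA0 : 0 < A := by positivity
      have hAB : A ≤ B := by
        rw [hA, hB]
        gcongr
        linarith
      have hB0 : 0 < B := by positivity
      have hdiff : B - A = s ^ 2 * (2 * n + 1) := by rw [hA, hB]; ring
      rw [← mul_sub, div_sub_div _ _ hA0.ne' hB0.ne', one_mul, mul_one, hdiff]
      have : 1 / s ^ 2 * (s ^ 2 * (2 * n + 1) / (A * B)) = (2 * (n : ℝ) + 1) / (A * B) := by
        field_simp
      rw [this]
      calc ((n : ℝ) + 1) / B ^ 2 ≤ (2 * (n : ℝ) + 1) / B ^ 2 := by gcongr; linarith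
        _ ≤ _ := by
          gcongr
          rw [pow_two]
          gcongr
    refine (Finset.sum_le_sum fun n _ => step n).trans ?_
    rw [Finset.sum_range_sub' (fun n : ℕ => 1 / s ^ 2 * (1 / (1 + (s * (n : ℝ)) ^ 2)))]
    have : 0 ≤ 1 / s ^ 2 * (1 / (1 + (s * (N : ℝ)) ^ 2)) := by positivity
    simp only [Nat.cast_zero, mul_zero]
    norm_num
    norm_num at this
    linarith
  have hsum := summable_of_sum_range_le
    (f := fun n : ℕ => ((n : ℝ) + 1) / (1 + (s * (n + 1)) ^ 2) ^ 2)
    (fun n => by positivity) key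
  exact ⟨hsum, hsum.tsum_le_of_sum_range_le key⟩

theorem heatCoeff_bound {s : ℝ} (hs : 0 < s) (hs1 : s ≤ 1) (n : ℕ) :
    ((n : ℝ) + 1) * |heatCoeff s (n + 1)| ≤
      3 * 20 ^ 5 / s * (((n : ℝ) + 1) / (1 + (s * (n + 1)) ^ 2) ^ 2) := by
  set x : ℝ := (n : ℝ) + 1 with hx
  have hx0 : 0 < x := by positivity
  rw [heatCoeff, abs_of_nonneg (by positivity)]
  have h1 : s * x ≤ 1 + (s * x) ^ 2 := by nlinarith [sq_nonneg (s * x - 1)]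
  have h2 : (1 : ℝ) ≤ 1 + (s * x) ^ 2 := by nlinarith [sq_nonneg (s * x)]
  calc x * (x * Real.exp (-s ^ 2 * (x ^ 2 - 1) / 4))
      ≤ x * (x * (3 * 20 ^ 5 / (1 + (s * x) ^ 2) ^ 5)) := by
        gcongr
        exact exp_heat_le hs hs1 x
    _ = 3 * 20 ^ 5 / s * (x / (1 + (s * x) ^ 2) ^ 2) * ((s * x) / (1 + (s * x) ^ 2) ^ 3) := by
        field_simp
    _ ≤ 3 * 20 ^ 5 / s * (x / (1 + (s * x) ^ 2) ^ 2) * 1 := by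
        gcongr
        rw [div_le_one (by positivity)]
        exact h1.trans (le_self_pow₀ h2 (by norm_num))
    _ = _ := mul_one _

theorem summable_heatCoeff {s : ℝ} (hs : 0 < s) (hs1 : s ≤ 1) :
    Summable fun n : ℕ => ((n : ℝ) + 1) * |heatCoeff s n| := by
  rw [← summable_nat_add_iff 1]
  have hs2 := (summable_and_tsum_telescope_le hs).1.mul_left (3 * 20 ^ 5 / s)
  refine (hs2.mul_left 2).of_nonneg_of_le (fun n => by positivity) fun n => ?_
  push_cast
  have h := heatCoeff_bound hs hs1 n
  have h0 : 0 ≤ (n : ℝ) * |heatCoeff s (n + 1)| := by positivity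
  have h1 : 0 ≤ |heatCoeff s (n + 1)| := by positivity
  nlinarith

/-- A character series is bounded uniformly on the group when its coefficients, weighted by the
dimensions, are dominated by a telescoping series. -/
theorem abs_tsum_mul_chi_le {s C : ℝ} (hs : 0 < s) {β : ℝ → ℝ}
    (h : ∀ n : ℕ, ((n : ℝ) + 1) * |β (n + 1)| ≤
      C * (((n : ℝ) + 1) / (1 + (s * (n + 1)) ^ 2) ^ 2)) (g : SU2) :
    |∑' n : ℕ, β (n + 1) * chi n g| ≤ C * (1 / s ^ 2) := by
  obtain ⟨h1, h2⟩ := summable_and_tsum_telescope_le hs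
  have hC : 0 ≤ C := by
    have := (by positivity : (0 : ℝ) ≤ ((0 : ℕ) + 1) * |β ((0 : ℕ) + 1)|).trans (h 0)
    by_contra hneg
    have : C * ((((0 : ℕ) : ℝ) + 1) / (1 + (s * ((0 : ℕ) + 1)) ^ 2) ^ 2) < 0 :=
      mul_neg_of_neg_of_pos (not_le.1 hneg) (by positivity)
    linarith
  calc |∑' n : ℕ, β (n + 1) * chi n g|
      ≤ ∑' n : ℕ, C * (((n : ℝ) + 1) / (1 + (s * (n + 1)) ^ 2) ^ 2) := by
        rw [← Real.norm_eq_abs]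
        refine tsum_of_norm_bounded (h1.mul_left C).hasSum fun n => ?_
        rw [Real.norm_eq_abs, abs_mul, mul_comm]
        exact (mul_le_mul_of_nonneg_right (abs_chi_le g n) (abs_nonneg _)).trans (h n)
    _ ≤ C * (1 / s ^ 2) := by
        rw [tsum_mul_left]
        gcongr

/-- The derivative of `P(x) e^{-s²(x²-1)/4}` for a polynomial `P`, given `P'`. -/
theorem hasDerivAt_mul_exp {s : ℝ} {P : ℝ → ℝ} {x P' Q : ℝ} (hP : HasDerivAt P P' x)
    (hQ : Q = P' - s ^ 2 * x / 2 * P x) :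
    HasDerivAt (fun x => P x * Real.exp (-s ^ 2 * (x ^ 2 - 1) / 4))
      (Q * Real.exp (-s ^ 2 * (x ^ 2 - 1) / 4)) x := by
  have h1 : HasDerivAt (fun x : ℝ => -s ^ 2 * (x ^ 2 - 1) / 4) (-s ^ 2 * (2 * x) / 4) x := by
    have := ((((hasDerivAt_id x).pow 2).sub_const 1).const_mul (-s ^ 2)).div_const 4
    simpa using this
  convert! hP.mul h1.exp using 1
  rw [hQ]
  ring

/-- The left-hand side is the fourth derivative of `heatCoeff s` at `x`. -/
theorem abs_heatCoeff_fourth_deriv_le {s : ℝ} (hs : 0 < s) (hs1 : s ≤ 1) (x : ℝ) :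
    |(15 * s ^ 4 * x / 4 - 5 * s ^ 6 * x ^ 3 / 4 + s ^ 8 * x ^ 5 / 16) *
      Real.exp (-s ^ 2 * (x ^ 2 - 1) / 4)| ≤ 18 * 20 ^ 5 * s ^ 3 / (1 + (s * x) ^ 2) ^ 2 := by
  set y := s * x with hy
  have e : 15 * s ^ 4 * x / 4 - 5 * s ^ 6 * x ^ 3 / 4 + s ^ 8 * x ^ 5 / 16 =
      s ^ 3 * (15 / 4 * y - 5 / 4 * y ^ 3 + 1 / 16 * y ^ 5) := by
    rw [hy]
    ring
  set z := 1 + y ^ 2 with hz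
  have hz1 : 1 ≤ z := by nlinarith [sq_nonneg y]
  have hyz : |y| ≤ z := by
    rw [hz]
    nlinarith [sq_nonneg (|y| - 1), sq_abs y, abs_nonneg y]
  have h1 : |y| ≤ z ^ 3 := hyz.trans (le_self_pow₀ hz1 (by norm_num))
  have hy2 : |y| ^ 2 ≤ z := by rw [sq_abs, hz]; linarith
  have h3 : |y| ^ 3 ≤ z ^ 3 := pow_le_pow_left₀ (abs_nonneg _) hyz 3
  have h5 : |y| ^ 5 ≤ z ^ 3 := by
    calc |y| ^ 5 = |y| * (|y| ^ 2) ^ 2 := by ring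
      _ ≤ z * z ^ 2 := by gcongr
      _ = z ^ 3 := by ring
  have hp : |15 / 4 * y - 5 / 4 * y ^ 3 + 1 / 16 * y ^ 5| ≤ 6 * z ^ 3 := by
    calc |15 / 4 * y - 5 / 4 * y ^ 3 + 1 / 16 * y ^ 5|
        ≤ |15 / 4 * y| + |5 / 4 * y ^ 3| + |1 / 16 * y ^ 5| :=
          (abs_add_le _ _).trans (add_le_add_left (abs_sub _ _) _)
      _ = 15 / 4 * |y| + 5 / 4 * |y| ^ 3 + 1 / 16 * |y| ^ 5 := by
          simp only [abs_mul, abs_pow]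
          norm_num
      _ ≤ 6 * z ^ 3 := by
          have : 0 ≤ z ^ 3 := by positivity
          linarith
  rw [e, abs_mul, abs_mul, abs_of_pos (Real.exp_pos _), abs_of_pos (pow_pos hs 3)]
  calc s ^ 3 * |15 / 4 * y - 5 / 4 * y ^ 3 + 1 / 16 * y ^ 5| *
        Real.exp (-s ^ 2 * (x ^ 2 - 1) / 4)
      ≤ s ^ 3 * (6 * z ^ 3) * (3 * 20 ^ 5 / z ^ 5) := by
        gcongr
        exact exp_heat_le hs hs1 x
    _ = _ := by
        field_simp
        ring

/-- Second-difference bound for the heat kernel: it decays like the inverse fourth power of the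
distance to the identity. -/
theorem sq_mul_abs_heatKernel_le {s : ℝ} (hs : 0 < s) (hs1 : s ≤ 1) (g : SU2) :
    (2 - reTrace g) ^ 2 * |heatKernel (s ^ 2) g| ≤ 5832 * 20 ^ 5 * s := by
  have hodd : ∀ x, heatCoeff s (-x) = -heatCoeff s x := fun x => by simp [heatCoeff]
  have h00 : heatCoeff s 0 = 0 := by simp [heatCoeff]
  have h10 : secondDiff (heatCoeff s) 0 = 0 := by
    rw [secondDiff, zero_sub, zero_add, hodd, h00]
    ring
  have hs0 := summable_heatCoeff hs hs1
  have e : (2 - reTrace g) ^ 2 * heatKernel (s ^ 2) g =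
      ∑' n : ℕ, secondDiff (secondDiff (heatCoeff s)) (n + 1) * chi n g := by
    rw [heatKernel_eq, pow_two, mul_assoc, two_sub_reTrace_mul_tsum h00 hs0,
      two_sub_reTrace_mul_tsum h10 (summable_secondDiff hs0)]
  have habs : (2 - reTrace g) ^ 2 * |heatKernel (s ^ 2) g| =
      |(2 - reTrace g) ^ 2 * heatKernel (s ^ 2) g| := by
    rw [abs_mul, abs_of_nonneg (sq_nonneg (2 - reTrace g))]
  rw [habs, e]
  have d0 : ∀ x, HasDerivAt (heatCoeff s)
      ((1 - s ^ 2 * x ^ 2 / 2) * Real.exp (-s ^ 2 * (x ^ 2 - 1) / 4)) x := fun x =>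
    hasDerivAt_mul_exp (P := fun x => x) (hasDerivAt_id x) (by ring)
  have d1 : ∀ x, HasDerivAt (fun x => (1 - s ^ 2 * x ^ 2 / 2) *
      Real.exp (-s ^ 2 * (x ^ 2 - 1) / 4))
      ((-3 * s ^ 2 * x / 2 + s ^ 4 * x ^ 3 / 4) * Real.exp (-s ^ 2 * (x ^ 2 - 1) / 4)) x :=
    fun x => hasDerivAt_mul_exp (P := fun x => 1 - s ^ 2 * x ^ 2 / 2)
      ((((hasDerivAt_pow 2 x).const_mul (s ^ 2)).div_const 2).const_sub 1) (by norm_num; ring)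
  have d2 : ∀ x, HasDerivAt (fun x => (-3 * s ^ 2 * x / 2 + s ^ 4 * x ^ 3 / 4) *
      Real.exp (-s ^ 2 * (x ^ 2 - 1) / 4))
      ((-3 * s ^ 2 / 2 + 3 * s ^ 4 * x ^ 2 / 2 - s ^ 6 * x ^ 4 / 8) *
        Real.exp (-s ^ 2 * (x ^ 2 - 1) / 4)) x :=
    fun x => hasDerivAt_mul_exp (P := fun x => -3 * s ^ 2 * x / 2 + s ^ 4 * x ^ 3 / 4)
      ((((hasDerivAt_id x).const_mul (-3 * s ^ 2)).div_const 2).add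
        (((hasDerivAt_pow 3 x).const_mul (s ^ 4)).div_const 4)) (by norm_num; ring)
  have d3 : ∀ x, HasDerivAt (fun x => (-3 * s ^ 2 / 2 + 3 * s ^ 4 * x ^ 2 / 2 -
        s ^ 6 * x ^ 4 / 8) * Real.exp (-s ^ 2 * (x ^ 2 - 1) / 4))
      ((15 * s ^ 4 * x / 4 - 5 * s ^ 6 * x ^ 3 / 4 + s ^ 8 * x ^ 5 / 16) *
        Real.exp (-s ^ 2 * (x ^ 2 - 1) / 4)) x :=
    fun x => hasDerivAt_mul_exp
      (P := fun x => -3 * s ^ 2 / 2 + 3 * s ^ 4 * x ^ 2 / 2 - s ^ 6 * x ^ 4 / 8)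
      (((((hasDerivAt_pow 2 x).const_mul (3 * s ^ 4)).div_const 2).const_add (-3 * s ^ 2 / 2)).sub
        (((hasDerivAt_pow 4 x).const_mul (s ^ 6)).div_const 8)) (by norm_num; ring)
  have hfin := abs_tsum_mul_chi_le (C := 5832 * 20 ^ 5 * s ^ 3) hs
    (β := secondDiff (secondDiff (heatCoeff s))) (fun n => ?_) g
  · refine hfin.trans (le_of_eq ?_)
    field_simp
  have hM : ∀ y : ℝ, |y - ((n : ℝ) + 1)| ≤ 2 →
      |(15 * s ^ 4 * y / 4 - 5 * s ^ 6 * y ^ 3 / 4 + s ^ 8 * y ^ 5 / 16) *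
        Real.exp (-s ^ 2 * (y ^ 2 - 1) / 4)| ≤
      1458 * 20 ^ 5 * s ^ 3 / (1 + (s * ((n : ℝ) + 1)) ^ 2) ^ 2 := by
    intro y hy
    refine (abs_heatCoeff_fourth_deriv_le hs hs1 y).trans ?_
    set k : ℝ := (n : ℝ) + 1
    -- the weight changes at most by the factor `9` over a distance `2`
    have hk : k ^ 2 ≤ 2 * y ^ 2 + 8 := by
      have := sq_le_sq' (abs_le.1 hy).1 (abs_le.1 hy).2
      nlinarith [sq_nonneg (y + (y - k))]
    have hw : 1 + (s * k) ^ 2 ≤ 9 * (1 + (s * y) ^ 2) := by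
      have h1 : s ^ 2 ≤ 1 := by nlinarith
      have h2 : s ^ 2 * k ^ 2 ≤ s ^ 2 * (2 * y ^ 2 + 8) := by gcongr
      nlinarith [mul_nonneg (sq_nonneg s) (sq_nonneg y)]
    rw [div_le_div_iff₀ (by positivity) (by positivity)]
    have hw2 := pow_le_pow_left₀ (by positivity) hw 2
    calc 18 * 20 ^ 5 * s ^ 3 * (1 + (s * k) ^ 2) ^ 2
        ≤ 18 * 20 ^ 5 * s ^ 3 * (9 * (1 + (s * y) ^ 2)) ^ 2 := by gcongr
      _ = _ := by ring
  have hb := abs_secondDiff_secondDiff_le d0 d1 d2 d3 hM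
  calc ((n : ℝ) + 1) * |secondDiff (secondDiff (heatCoeff s)) (n + 1)|
      ≤ ((n : ℝ) + 1) * (4 * (1458 * 20 ^ 5 * s ^ 3 / (1 + (s * ((n : ℝ) + 1)) ^ 2) ^ 2)) := by
        gcongr
    _ = _ := by ring

theorem abs_heatKernel_le {s : ℝ} (hs : 0 < s) (hs1 : s ≤ 1) (g : SU2) :
    |heatKernel (s ^ 2) g| ≤ 3 * 20 ^ 5 / s ^ 3 := by
  rw [heatKernel_eq]
  refine (abs_tsum_mul_chi_le hs (heatCoeff_bound hs hs1) g).trans (le_of_eq ?_)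
  field_simp

/-- The weight `(1 + (2 - tr g) / s²)⁻²`; here `2 - tr g` is a squared distance to the identity. -/
def weight (s : ℝ) (g : SU2) : ℝ := ((1 + (2 - reTrace g) / s ^ 2) ^ 2)⁻¹

theorem two_sub_reTrace_nonneg (g : SU2) : 0 ≤ 2 - reTrace g := by
  linarith [(abs_le.1 (abs_reTrace_le g)).2]

theorem weight_pos (s : ℝ) (g : SU2) : 0 < weight s g := by
  have := two_sub_reTrace_nonneg g
  unfold weight
  positivity

theorem weight_le_one (s : ℝ) (g : SU2) : weight s g ≤ 1 := by
  have := two_sub_reTrace_nonneg g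
  unfold weight
  refine inv_le_one_of_one_le₀ (one_le_pow₀ ?_)
  have : 0 ≤ (2 - reTrace g) / s ^ 2 := by positivity
  linarith

/-- The heat kernel is dominated by the weight: a consequence of its sup bound and of its decay. -/
theorem abs_heatKernel_le_weight {s : ℝ} (hs : 0 < s) (hs1 : s ≤ 1) (g : SU2) :
    |heatKernel (s ^ 2) g| ≤ 11670 * 20 ^ 5 / s ^ 3 * weight s g := by
  have h0 := abs_heatKernel_le hs hs1 g
  have h1 := sq_mul_abs_heatKernel_le hs hs1 g
  have hq := two_sub_reTrace_nonneg g
  rw [weight, ← div_eq_mul_inv, le_div_iff₀ (by positivity)]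
  set q := 2 - reTrace g
  set k := |heatKernel (s ^ 2) g|
  have hk : 0 ≤ k := abs_nonneg _
  have h2 : (1 + q / s ^ 2) ^ 2 ≤ 2 + 2 * (q ^ 2 / s ^ 4) := by
    have : q ^ 2 / s ^ 4 = (q / s ^ 2) ^ 2 := by rw [div_pow]; ring
    rw [this]
    nlinarith [sq_nonneg (q / s ^ 2 - 1)]
  calc k * (1 + q / s ^ 2) ^ 2 ≤ k * (2 + 2 * (q ^ 2 / s ^ 4)) := by gcongr
    _ = 2 * k + 2 * (q ^ 2 * k) / s ^ 4 := by ring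
    _ ≤ 2 * (3 * 20 ^ 5 / s ^ 3) + 2 * (5832 * 20 ^ 5 * s) / s ^ 4 := by gcongr
    _ = _ := by
        field_simp
        norm_num

/-- The terms of dimension at most `2 / s` already contribute order `s⁻³`. -/
theorem le_heatKernel_one {s : ℝ} (hs : 0 < s) (hs1 : s ≤ 1) :
    1 / 9 / s ^ 3 ≤ heatKernel (s ^ 2) 1 := by
  set m : ℕ := ⌈1 / s⌉₊ with hm
  have hm1 : 1 / s ≤ m := Nat.le_ceil _
  have hm2 : (m : ℝ) ≤ 2 / s := by
    have h1 : (m : ℝ) < 1 / s + 1 := Nat.ceil_lt_add_one (by positivity)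
    have h2 : 1 ≤ 1 / s := by rwa [le_div_iff₀ hs, one_mul]
    have : 2 / s = 1 / s + 1 / s := by ring
    linarith
  have hsum := summable_mul_chi (β := fun n => heatCoeff s (n + 1))
    (summable_shift (summable_heatCoeff hs hs1)) 1
  rw [heatKernel_eq]
  have hterm : ∀ n ∈ Finset.range m, 1 / 3 * ((n : ℝ) + 1) ^ 2 ≤
      heatCoeff s (n + 1) * chi n 1 := by
    intro n hn
    have hn' : (n : ℝ) + 1 ≤ m := by exact_mod_cast Finset.mem_range.1 hn
    have hx : s * ((n : ℝ) + 1) ≤ 2 := by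
      have := (le_div_iff₀ hs).1 (hn'.trans hm2)
      linarith
    have he : 1 / 3 ≤ Real.exp (-s ^ 2 * (((n : ℝ) + 1) ^ 2 - 1) / 4) := by
      have h1 : Real.exp (-1) ≤ Real.exp (-s ^ 2 * (((n : ℝ) + 1) ^ 2 - 1) / 4) := by
        apply Real.exp_le_exp.2
        have : (s * ((n : ℝ) + 1)) ^ 2 ≤ 2 ^ 2 := pow_le_pow_left₀ (by positivity) hx 2
        nlinarith [sq_nonneg s]
      refine le_trans ?_ h1
      rw [Real.exp_neg, one_div]
      exact inv_anti₀ (Real.exp_pos _) Real.exp_one_lt_three.le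
    rw [chi_at_one, heatCoeff]
    calc 1 / 3 * ((n : ℝ) + 1) ^ 2
        ≤ Real.exp (-s ^ 2 * (((n : ℝ) + 1) ^ 2 - 1) / 4) * ((n : ℝ) + 1) ^ 2 := by gcongr
      _ = _ := by ring
  have hle : ∑ n ∈ Finset.range m, heatCoeff s (n + 1) * chi n 1 ≤
      ∑' n : ℕ, heatCoeff s (n + 1) * chi n 1 :=
    hsum.sum_le_tsum _ fun n _ => by
      rw [chi_at_one, heatCoeff]
      positivity
  refine le_trans ?_ hle
  refine le_trans ?_ (Finset.sum_le_sum hterm)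
  rw [← Finset.mul_sum]
  have hcube : ∀ m : ℕ, (m : ℝ) ^ 3 / 3 ≤ ∑ n ∈ Finset.range m, ((n : ℝ) + 1) ^ 2 := by
    intro m
    induction m with
    | zero => simp
    | succ m ih =>
      rw [Finset.sum_range_succ]
      push_cast
      have : (0 : ℝ) ≤ m := Nat.cast_nonneg m
      nlinarith
  have h3 : (1 / s) ^ 3 ≤ (m : ℝ) ^ 3 := pow_le_pow_left₀ (by positivity) hm1 3
  have h4 : 1 / 9 / s ^ 3 = 1 / 3 * ((1 / s) ^ 3 / 3) := by
    field_simp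
    norm_num
  rw [h4]
  have := hcube m
  gcongr
  linarith

/-! ### The bi-invariant distance on `SU(2)` -/

theorem reTrace_eq (g : SU2) : reTrace g = 2 * ((g : Matrix (Fin 2) (Fin 2) ℂ) 0 0).re := by
  simp [reTrace, Matrix.trace_fin_two, coe_one_one]
  ring

theorem reTrace_mul_comm (g h : SU2) : reTrace (g * h) = reTrace (h * g) := by
  simp only [reTrace, Submonoid.coe_mul]
  rw [Matrix.trace_mul_comm]

theorem reTrace_inv (g : SU2) : reTrace g⁻¹ = reTrace g := by
  simp [reTrace_eq, coe_inv, Matrix.star_apply]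

theorem continuous_reTrace : Continuous reTrace := by
  have : Continuous fun g : SU2 => (g : Matrix (Fin 2) (Fin 2) ℂ) := continuous_subtype_val
  exact Complex.continuous_re.comp this.matrix_trace

/-- The distance from `g` to the identity of `SU(2)`: the chordal distance of the three-sphere. -/
def distOne (g : SU2) : ℝ := Real.sqrt (2 - reTrace g)

theorem distOne_nonneg (g : SU2) : 0 ≤ distOne g := Real.sqrt_nonneg _

theorem distOne_sq (g : SU2) : distOne g ^ 2 = 2 - reTrace g :=
  Real.sq_sqrt (two_sub_reTrace_nonneg g)

theorem distOne_inv (g : SU2) : distOne g⁻¹ = distOne g := by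
  rw [distOne, reTrace_inv, distOne]

theorem distOne_mul_comm (g h : SU2) : distOne (g * h) = distOne (h * g) := by
  rw [distOne, reTrace_mul_comm, distOne]

theorem distOne_conj (g h : SU2) : distOne (h * g * h⁻¹) = distOne g := by
  rw [distOne_mul_comm, inv_mul_cancel_left]

section OperatorNorm

open scoped Matrix.Norms.L2Operator

/-- This identity provides the triangle inequality for `distOne`. -/
theorem distOne_eq_norm (g : SU2) : distOne g = ‖(g : Matrix (Fin 2) (Fin 2) ℂ) - 1‖ := by
  have h1 := Matrix.mem_unitaryGroup_iff'.1 (Matrix.mem_specialUnitaryGroup_iff.1 g.2).1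
  have h2 : (g : Matrix (Fin 2) (Fin 2) ℂ) + star (g : Matrix (Fin 2) (Fin 2) ℂ) =
      (reTrace g : ℂ) • 1 := by
    rw [← trace_eq_reTrace, Matrix.trace_fin_two]
    ext i j
    fin_cases i <;> fin_cases j <;>
      simp [Matrix.star_apply, coe_one_one, coe_one_zero]
    ring
  -- by the C⋆-identity, since `(g - 1)⋆ (g - 1) = (2 - tr g) • 1`
  have h3 : star ((g : Matrix (Fin 2) (Fin 2) ℂ) - 1) * ((g : Matrix (Fin 2) (Fin 2) ℂ) - 1) =
      ((2 - reTrace g : ℝ) : ℂ) • 1 := by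
    have : star ((g : Matrix (Fin 2) (Fin 2) ℂ) - 1) * ((g : Matrix (Fin 2) (Fin 2) ℂ) - 1) =
        2 - ((g : Matrix (Fin 2) (Fin 2) ℂ) + star (g : Matrix (Fin 2) (Fin 2) ℂ)) := by
      rw [star_sub, star_one, sub_mul, mul_sub, h1, one_mul, mul_one,
        show (2 : Matrix (Fin 2) (Fin 2) ℂ) = 1 + 1 by norm_num]
      abel
    rw [this, h2]
    push_cast
    rw [sub_smul, ofNat_smul_eq_nsmul]
    simp [two_smul, one_add_one_eq_two]
  have h4 := CStarRing.norm_star_mul_self (x := (g : Matrix (Fin 2) (Fin 2) ℂ) - 1)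
  rw [h3, norm_smul, Complex.norm_real, Real.norm_eq_abs,
    abs_of_nonneg (two_sub_reTrace_nonneg g), CStarRing.norm_one, mul_one] at h4
  rw [distOne, h4, Real.sqrt_mul_self (norm_nonneg _)]

theorem distOne_mul_le (g h : SU2) : distOne (g * h) ≤ distOne g + distOne h := by
  simp only [distOne_eq_norm, Submonoid.coe_mul]
  have e : (g : Matrix (Fin 2) (Fin 2) ℂ) * h - 1 =
      ((g : Matrix (Fin 2) (Fin 2) ℂ) - 1) + g * ((h : Matrix (Fin 2) (Fin 2) ℂ) - 1) := by
    rw [mul_sub, mul_one]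
    abel
  rw [e]
  refine (norm_add_le _ _).trans (add_le_add_right (le_of_eq ?_) _)
  exact CStarRing.norm_mem_unitary_mul _ (Matrix.mem_specialUnitaryGroup_iff.1 g.2).1

end OperatorNorm

theorem weight_eq (s : ℝ) (g : SU2) : weight s g = ((1 + distOne g ^ 2 / s ^ 2) ^ 2)⁻¹ := by
  rw [distOne_sq, weight]

theorem weight_congr {g h : SU2} (e : distOne g = distOne h) (s : ℝ) :
    weight s g = weight s h := by
  rw [weight_eq, weight_eq, e]

theorem weight_le_of_distOne_le {a c : SU2} (h : distOne c ≤ 2 * distOne a) {s : ℝ} (hs : 0 < s) :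
    weight s a ≤ 16 * weight s c := by
  have hc := distOne_nonneg c
  rw [weight_eq, weight_eq, ← div_eq_mul_inv, le_div_iff₀ (by positivity),
    inv_mul_le_iff₀ (by positivity)]
  have h1 : distOne c ^ 2 ≤ 4 * distOne a ^ 2 := by nlinarith
  have h2 : 1 + distOne c ^ 2 / s ^ 2 ≤ 4 * (1 + distOne a ^ 2 / s ^ 2) := by
    have : distOne c ^ 2 / s ^ 2 ≤ 4 * distOne a ^ 2 / s ^ 2 := by gcongr
    have e : 4 * distOne a ^ 2 / s ^ 2 = 4 * (distOne a ^ 2 / s ^ 2) := by ring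
    linarith
  calc (1 + distOne c ^ 2 / s ^ 2) ^ 2 ≤ (4 * (1 + distOne a ^ 2 / s ^ 2)) ^ 2 := by gcongr
    _ = _ := by ring

/-- If `c` is no farther from the identity than `a` and `b` together, then one of the weights of
`a`, `b` can be traded for that of `c`. -/
theorem weight_mul_weight_le {a b c : SU2} (h : distOne c ≤ distOne a + distOne b) {s : ℝ}
    (hs : 0 < s) : weight s a * weight s b ≤ 16 * weight s c * (weight s a + weight s b) := by
  have ha := weight_pos s a
  have hb := weight_pos s b
  have hc := weight_pos s c
  rcases le_total (distOne a) (distOne b) with hab | hab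
  · have := weight_le_of_distOne_le (a := b) (c := c) (by linarith) hs
    calc weight s a * weight s b ≤ weight s a * (16 * weight s c) := by gcongr
      _ ≤ _ := by nlinarith [mul_pos hc hb]
  · have := weight_le_of_distOne_le (a := a) (c := c) (by linarith) hs
    calc weight s a * weight s b ≤ (16 * weight s c) * weight s b := by gcongr
      _ ≤ _ := by nlinarith [mul_pos hc ha]

/-! ### Haar measure of balls and the integral of the weight -/

instance : IsProbabilityMeasure haar := ⟨by
  have := Measure.haarMeasure_self (K₀ := (⊤ : TopologicalSpace.PositiveCompacts SU2))
  simpa [haar] using this⟩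

instance : haar.IsMulLeftInvariant :=
  inferInstanceAs (Measure.haarMeasure _).IsMulLeftInvariant

/-- The element of `SU(2)` whose coordinates on the three-sphere are `√(1 - |x|²)` and `x`. -/
def spherePoint (x : Fin 3 → ℝ) (hx : ∑ i, x i ^ 2 ≤ 1) : SU2 :=
  ⟨!![⟨Real.sqrt (1 - ∑ i, x i ^ 2), x 0⟩, ⟨x 1, x 2⟩;
      ⟨-x 1, x 2⟩, ⟨Real.sqrt (1 - ∑ i, x i ^ 2), -x 0⟩], by
    have h : Real.sqrt (1 - ∑ i, x i ^ 2) * Real.sqrt (1 - ∑ i, x i ^ 2) =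
      1 - ∑ i, x i ^ 2 := Real.mul_self_sqrt (by linarith)
    rw [Fin.sum_univ_three] at h
    rw [Fin.sum_univ_three]
    rw [Matrix.mem_specialUnitaryGroup_iff, Matrix.mem_unitaryGroup_iff]
    constructor
    · ext i j
      fin_cases i <;> fin_cases j <;> apply Complex.ext <;>
        simp [Matrix.mul_apply, Fin.sum_univ_two, Matrix.star_apply] <;>
        first | ring1 | linear_combination h
    · rw [Matrix.det_fin_two_of]
      apply Complex.ext <;> simp <;> first | ring1 | linear_combination h⟩

/-- Moving a coordinate on the three-sphere moves the point at least as far. -/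
theorem distOne_spherePoint (x y : Fin 3 → ℝ) (hx : ∑ i, x i ^ 2 ≤ 1) (hy : ∑ i, y i ^ 2 ≤ 1)
    (i : Fin 3) : |x i - y i| ≤ distOne ((spherePoint x hx)⁻¹ * spherePoint y hy) := by
  apply abs_le_of_sq_le_sq' _ (distOne_nonneg _) |> abs_le.2
  rw [distOne_sq, reTrace_eq, Submonoid.coe_mul, coe_inv]
  have h1 := Real.mul_self_sqrt (by linarith : 0 ≤ 1 - ∑ i, x i ^ 2)
  have h2 := Real.mul_self_sqrt (by linarith : 0 ≤ 1 - ∑ i, y i ^ 2)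
  have h3 := Finset.single_le_sum (f := fun i => (x i - y i) ^ 2) (fun i _ => sq_nonneg _)
    (Finset.mem_univ i)
  refine h3.trans ?_
  simp only [spherePoint, Matrix.mul_apply, Fin.sum_univ_two, Matrix.star_apply]
  simp
  simp only [Fin.sum_univ_three] at h1 h2 ⊢
  nlinarith [sq_nonneg (Real.sqrt (1 - (x 0 ^ 2 + x 1 ^ 2 + x 2 ^ 2)) -
    Real.sqrt (1 - (y 0 ^ 2 + y 1 ^ 2 + y 2 ^ 2)))]

/-- The points of a cubic grid of spacing `1 / (2M)` lift to separated points of the three-sphere;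
translates of the ball around them are disjoint. -/
theorem haar_ball_le_of_nat {M : ℕ} (hM : 0 < M) :
    haar {g | distOne g < 1 / (4 * M)} ≤ ENNReal.ofReal (1 / (M : ℝ) ^ 3) := by
  have hM' : (0 : ℝ) < M := by exact_mod_cast hM
  let x : (Fin 3 → Fin M) → Fin 3 → ℝ := fun k i => (k i : ℝ) / (2 * M)
  have hx : ∀ k, ∑ i, x k i ^ 2 ≤ 1 := by
    intro k
    have h1 : ∀ i, x k i ^ 2 ≤ 1 / 4 := by
      intro i
      have h2 : (k i : ℝ) ≤ M := by exact_mod_cast (k i).2.le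
      have h3 : x k i ≤ 1 / 2 := by
        rw [div_le_div_iff₀ (by positivity) (by norm_num)]
        linarith
      have h4 : 0 ≤ x k i := by positivity
      nlinarith
    rw [Fin.sum_univ_three]
    linarith [h1 0, h1 1, h1 2]
  let p : (Fin 3 → Fin M) → SU2 := fun k => spherePoint (x k) (hx k)
  let B : Set SU2 := {g | distOne g < 1 / (4 * M)}
  have hBm : MeasurableSet B := by
    apply IsOpen.measurableSet
    exact isOpen_lt (Real.continuous_sqrt.comp (continuous_const.sub continuous_reTrace))
      continuous_const
  have hdisj : Pairwise (Function.onFun Disjoint fun k => (fun z => (p k)⁻¹ * z) ⁻¹' B) := by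
    intro k l hkl
    rw [Function.onFun, Set.disjoint_left]
    intro z hz1 hz2
    obtain ⟨i, hi⟩ := Function.ne_iff.1 hkl
    have h1 : (1 : ℝ) ≤ |(k i : ℝ) - l i| := by
      have : ((k i : ℕ) : ℤ) - ((l i : ℕ) : ℤ) ≠ 0 := by
        intro h
        apply hi
        apply Fin.ext
        omega
      exact_mod_cast Int.one_le_abs this
    have h2 : 1 / (2 * M) ≤ |x k i - x l i| := by
      rw [← sub_div, abs_div, abs_of_pos (by positivity : (0 : ℝ) < 2 * M)]
      gcongr
    have h3 := distOne_spherePoint (x k) (x l) (hx k) (hx l) i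
    have h4 : distOne ((p k)⁻¹ * p l) ≤ distOne ((p k)⁻¹ * z) + distOne ((p l)⁻¹ * z) := by
      rw [← distOne_inv ((p l)⁻¹ * z)]
      have e : (p k)⁻¹ * p l = (p k)⁻¹ * z * ((p l)⁻¹ * z)⁻¹ := by group
      rw [e]
      exact distOne_mul_le _ _
    have h5 : distOne ((p k)⁻¹ * z) < 1 / (4 * M) := hz1
    have h6 : distOne ((p l)⁻¹ * z) < 1 / (4 * M) := hz2
    have h7 : (1 : ℝ) / (2 * M) = 1 / (4 * M) + 1 / (4 * M) := by
      field_simp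
      norm_num
    linarith
  have hsum : ∑ k, haar ((fun z => (p k)⁻¹ * z) ⁻¹' B) ≤ 1 := by
    rw [← tsum_fintype (L := SummationFilter.unconditional _), ← measure_iUnion hdisj fun k =>
      hBm.preimage (measurable_const_mul _)]
    exact prob_le_one
  simp only [measure_preimage_mul, Finset.sum_const, Finset.card_univ, Fintype.card_fun,
    Fintype.card_fin, nsmul_eq_mul] at hsum
  rw [one_div ((M : ℝ) ^ 3), ENNReal.ofReal_inv_of_pos (by positivity)]
  rw [ENNReal.le_inv_iff_mul_le, mul_comm]
  convert hsum
  rw [ENNReal.ofReal_pow hM'.le, ENNReal.ofReal_natCast]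
  push_cast
  rfl

theorem haar_ball_le {r : ℝ} (hr : 0 < r) :
    haar {g | distOne g < r} ≤ ENNReal.ofReal (512 * r ^ 3) := by
  rcases le_or_gt (1 / 4) r with h | h
  · refine prob_le_one.trans ?_
    rw [← ENNReal.ofReal_one]
    apply ENNReal.ofReal_le_ofReal
    have := pow_le_pow_left₀ (by norm_num) h 3
    norm_num at this
    linarith
  · set M : ℕ := ⌊1 / (4 * r)⌋₊ with hM
    have h1 : 1 ≤ 1 / (4 * r) := by
      rw [le_div_iff₀ (by positivity)]
      linarith
    have hM1 : 1 ≤ M := Nat.le_floor (by exact_mod_cast h1)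
    have hM1' : (1 : ℝ) ≤ M := by exact_mod_cast hM1
    have hM2 : (M : ℝ) ≤ 1 / (4 * r) := Nat.floor_le (by positivity)
    have hM3 : 1 / (4 * r) < M + 1 := Nat.lt_floor_add_one _
    have hr1 : r ≤ 1 / (4 * M) := by
      rw [le_div_iff₀ (by positivity)] at hM2 ⊢
      linarith
    have hr2 : 1 / (M : ℝ) ≤ 8 * r := by
      rw [div_lt_iff₀ (by positivity)] at hM3
      rw [div_le_iff₀ (by positivity)]
      nlinarith
    refine (measure_mono fun g (hg : distOne g < r) => hg.trans_le hr1).trans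
      ((haar_ball_le_of_nat hM1).trans (ENNReal.ofReal_le_ofReal ?_))
    calc 1 / (M : ℝ) ^ 3 = (1 / (M : ℝ)) ^ 3 := by rw [div_pow, one_pow]
      _ ≤ (8 * r) ^ 3 := by gcongr
      _ = _ := by ring

theorem continuous_weight {s : ℝ} (hs : 0 < s) : Continuous (weight s) := by
  unfold weight
  refine Continuous.inv₀ ?_ fun g => ?_
  · exact (continuous_const.add ((continuous_const.sub continuous_reTrace).div_const _)).pow 2
  · have := two_sub_reTrace_nonneg g
    positivity

/-- The weight has Haar integral of order `s³`, by a dyadic decomposition. -/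
theorem lintegral_weight_le {s : ℝ} (hs : 0 < s) :
    ∫⁻ g, ENNReal.ofReal (weight s g) ∂haar ≤ ENNReal.ofReal (16384 * s ^ 3) := by
  have hmeas : ∀ r : ℝ, MeasurableSet {g : SU2 | distOne g < r} := fun r =>
    (isOpen_lt (Real.continuous_sqrt.comp (continuous_const.sub continuous_reTrace))
      continuous_const).measurableSet
  have hpt : ∀ g, ENNReal.ofReal (weight s g) ≤ ∑' k : ℕ, ENNReal.ofReal (16 * (1 / 16) ^ k) *
      Set.indicator {g : SU2 | distOne g < 2 ^ k * s} 1 g := by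
    intro g
    have hex : ∃ k : ℕ, distOne g < 2 ^ k * s := by
      obtain ⟨k, hk⟩ := pow_unbounded_of_one_lt (distOne g / s) (one_lt_two : (1 : ℝ) < 2)
      exact ⟨k, by rwa [div_lt_iff₀ hs] at hk⟩
    classical
    have hk := Nat.find_spec hex
    have hmin := fun m => Nat.find_min hex (m := m)
    generalize Nat.find hex = k at hk hmin
    refine le_trans ?_ (ENNReal.le_tsum k)
    rw [Set.indicator_of_mem (show g ∈ {g : SU2 | distOne g < 2 ^ k * s} from hk), Pi.one_apply,
      mul_one]
    apply ENNReal.ofReal_le_ofReal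
    match k with
    | 0 =>
      have := weight_le_one s g
      norm_num
      linarith
    | m + 1 =>
      have h1 := not_lt.1 (hmin m (Nat.lt_succ_self m))
      have h2 : (2 : ℝ) ^ m ≤ distOne g / s := by rwa [le_div_iff₀ hs]
      have h3 : ((2 : ℝ) ^ m) ^ 4 ≤ (1 + distOne g ^ 2 / s ^ 2) ^ 2 := by
        calc ((2 : ℝ) ^ m) ^ 4 ≤ (distOne g / s) ^ 4 := by gcongr
          _ = (distOne g ^ 2 / s ^ 2) ^ 2 := by rw [← div_pow]; ring
          _ ≤ _ := by
            gcongr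
            linarith
      rw [weight_eq]
      calc ((1 + distOne g ^ 2 / s ^ 2) ^ 2)⁻¹ ≤ (((2 : ℝ) ^ m) ^ 4)⁻¹ :=
            inv_anti₀ (by positivity) h3
        _ = 16 * (1 / 16) ^ (m + 1) := by
            have e : ((2 : ℝ) ^ m) ^ 4 = 16 ^ m := by
              rw [← pow_mul, mul_comm, pow_mul]
              norm_num
            rw [e, pow_succ, one_div, inv_pow]
            ring
  have hgeo : Summable fun k : ℕ => 8192 * s ^ 3 * (1 / 2 : ℝ) ^ k :=
    summable_geometric_two.mul_left _
  calc ∫⁻ g, ENNReal.ofReal (weight s g) ∂haar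
      ≤ ∫⁻ g, ∑' k : ℕ, ENNReal.ofReal (16 * (1 / 16) ^ k) *
        Set.indicator {g : SU2 | distOne g < 2 ^ k * s} 1 g ∂haar := lintegral_mono hpt
    _ = ∑' k : ℕ, ENNReal.ofReal (16 * (1 / 16) ^ k) *
          haar {g : SU2 | distOne g < 2 ^ k * s} := by
        rw [lintegral_tsum fun k => ((measurable_one.indicator (hmeas _)).const_mul _).aemeasurable]
        refine tsum_congr fun k => ?_
        rw [lintegral_const_mul _ (measurable_one.indicator (hmeas _)),
          lintegral_indicator_one (hmeas _)]
    _ ≤ ∑' k : ℕ, ENNReal.ofReal (8192 * s ^ 3 * (1 / 2) ^ k) := by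
        refine ENNReal.tsum_le_tsum fun k => ?_
        refine (mul_le_mul_right (haar_ball_le (by positivity)) _).trans (le_of_eq ?_)
        rw [← ENNReal.ofReal_mul (by positivity)]
        congr 1
        have : (1 / 16 : ℝ) ^ k * (2 ^ k) ^ 3 = (1 / 2) ^ k := by
          rw [← pow_mul, mul_comm k 3, pow_mul, ← mul_pow]
          norm_num
        rw [← this]
        ring
    _ = ENNReal.ofReal (16384 * s ^ 3) := by
        rw [← ENNReal.ofReal_tsum_of_nonneg (fun k => by positivity) hgeo, tsum_mul_left,
          tsum_geometric_two]
        congr 1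
        ring

instance : SecondCountableTopology SU2 := by
  have : SecondCountableTopology (Matrix (Fin 2) (Fin 2) ℂ) :=
    inferInstanceAs (SecondCountableTopology (Fin 2 → Fin 2 → ℂ))
  exact TopologicalSpace.Subtype.secondCountableTopology _

/-- A left-invariant probability measure on a group is invariant under inversion: integrate
`f (x⁻¹ * y)` in both orders. -/
instance : haar.IsInvInvariant := ⟨by
  have key : ∀ f : SU2 → ENNReal, Measurable f → ∫⁻ x, f x⁻¹ ∂haar = ∫⁻ y, f y ∂haar := by
    intro f hf
    have h1 : ∀ y, ∫⁻ x, f (x⁻¹ * y) ∂haar = ∫⁻ x, f x⁻¹ ∂haar := by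
      intro y
      rw [← lintegral_mul_left_eq_self (fun x => f x⁻¹) y⁻¹]
      simp
    have h2 : ∀ x, ∫⁻ y, f (x⁻¹ * y) ∂haar = ∫⁻ y, f y ∂haar := fun x =>
      lintegral_mul_left_eq_self f x⁻¹
    calc ∫⁻ x, f x⁻¹ ∂haar = ∫⁻ y, ∫⁻ x, f (x⁻¹ * y) ∂haar ∂haar := by simp [h1]
      _ = ∫⁻ x, ∫⁻ y, f (x⁻¹ * y) ∂haar ∂haar := by
        rw [lintegral_lintegral_swap]
        exact (hf.comp (by fun_prop)).aemeasurable
      _ = _ := by simp [h2]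
  refine Measure.ext fun s hs => ?_
  rw [Measure.inv, Measure.map_apply measurable_inv hs,
    ← lintegral_indicator_one (hs.preimage measurable_inv), ← lintegral_indicator_one hs]
  exact key _ (measurable_one.indicator hs)⟩

/-- The cyclic rotation of three holonomies of product one. -/
theorem measurePreserving_rotate :
    MeasurePreserving (fun p : SU2 × SU2 => (p.2, (p.1 * p.2)⁻¹)) (haar.prod haar)
      (haar.prod haar) := by
  have h1 := Measure.measurePreserving_swap (μ := haar) (ν := haar)
  have h2 := (MeasurePreserving.id haar).prod (Measure.measurePreserving_inv haar)
  have h3 := measurePreserving_prod_inv_mul haar haar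
  convert! h3.comp (h2.comp h1) using 1
  ext p : 1
  simp

/-! ### Elimination of variables in an integral over a product -/

/-- If the factors can be removed one after another, each by integrating a variable on which no
other remaining factor depends, then the integral of the product is at most the product of the
bounds of the single integrations. -/
theorem lintegral_prod_le_of_elimination {E D X : Type*} [Fintype E] [DecidableEq E]
    [DecidableEq D] [MeasurableSpace X] [Nonempty X] (μ : Measure X) [IsProbabilityMeasure μ]
    (F : D → (E → X) → ℝ≥0∞) (hF : ∀ d, Measurable (F d)) (c : ℝ≥0∞) (S : Finset D)
    (h : ∀ S' ⊆ S, S'.Nonempty → ∃ d ∈ S', ∃ e : E,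
      (∀ d' ∈ S', d' ≠ d → ∀ x y, F d' (Function.update x e y) = F d' x) ∧
      ∀ x, ∫⁻ y, F d (Function.update x e y) ∂μ ≤ c) :
    ∫⁻ x, ∏ d ∈ S, F d x ∂(Measure.pi fun _ : E => μ) ≤ c ^ S.card := by
  induction S using Finset.strongInduction with
  | H S ih =>
    rcases S.eq_empty_or_nonempty with rfl | hS
    · simp
    · obtain ⟨d, hd, e, hind, hint⟩ := h S subset_rfl hS
      have ih' := ih (S.erase d) (Finset.erase_ssubset hd) fun S' hS' =>
        h S' (hS'.trans (Finset.erase_subset _ _))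
      set g : (E → X) → ℝ≥0∞ := fun x => ∏ d' ∈ S.erase d, F d' x with hg
      have hgm : Measurable g := Finset.measurable_prod _ fun d' _ => hF d'
      have hgu : ∀ x y, g (Function.update x e y) = g x := fun x y =>
        Finset.prod_congr rfl fun d' hd' =>
          hind d' (Finset.mem_of_mem_erase hd') (Finset.ne_of_mem_erase hd') x y
      have hfac : ∀ x, ∏ d ∈ S, F d x = F d x * g x := fun x =>
        (Finset.mul_prod_erase S (fun d => F d x) hd).symm
      simp only [hfac]
      have x0 : E → X := fun _ => Classical.arbitrary X
      have step : ∀ f : (E → X) → ℝ≥0∞, Measurable f → ∫⁻ x, f x ∂(Measure.pi fun _ : E => μ) =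
          (∫⋯∫⁻_(Finset.univ.erase e), (fun x => ∫⁻ y, f (Function.update x e y) ∂μ)
            ∂(fun _ : E => μ)) x0 := by
        intro f hf
        rw [← lmarginal_erase' _ hf (Finset.mem_univ e), lmarginal_univ]
      calc ∫⁻ x, F d x * g x ∂(Measure.pi fun _ : E => μ)
          ≤ ∫⁻ x, c * g x ∂(Measure.pi fun _ : E => μ) := by
            rw [step (fun x => F d x * g x) ((hF d).mul hgm),
              step (fun x => c * g x) (hgm.const_mul c)]
            refine lmarginal_mono (fun x => ?_) x0
            simp only [hgu, lintegral_const, measure_univ, mul_one]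
            rw [lintegral_mul_const (g x) (f := fun y => F d (Function.update x e y))
              ((hF d).comp (measurable_update x))]
            gcongr
            exact hint x
        _ = c * ∫⁻ x, g x ∂(Measure.pi fun _ : E => μ) := lintegral_const_mul _ hgm
        _ ≤ c * c ^ (S.erase d).card := by gcongr
        _ = c ^ S.card := by
            rw [← pow_succ', Finset.card_erase_add_one hd]

/-! ### Components of the subgraphs with given colours -/

namespace ColouredGraph

variable {W B : Type*} (G : ColouredGraph W B)

/-- Two nodes are joined by a line with colour in `C`. -/
def JoinedBy (C : Set (Fin 4)) (x y : W ⊕ B) : Prop := ∃ c ∈ C, G.Joined c x y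

/-- The number of connected components of the subgraph formed by the lines with colour in `C`. For
two colours these are the faces of the coloured graph. -/
def numComponents (C : Set (Fin 4)) : ℕ := Nat.card (Quot (G.JoinedBy C))

theorem lineAt_eq_iff {c : Fin 4} {x y : W ⊕ B} (h : G.Joined c x y) (m : W ⊕ B) :
    G.lineAt c m = G.lineAt c x ↔ m = x ∨ m = y := by
  obtain ⟨w, rfl, rfl⟩ := h
  cases m with
  | inl u => simp [lineAt]
  | inr b => simp [lineAt, Equiv.symm_apply_eq]

theorem lineAt_eq_of_joined {c : Fin 4} {x y : W ⊕ B} (h : G.Joined c x y) :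
    G.lineAt c y = G.lineAt c x := (G.lineAt_eq_iff h y).2 (Or.inr rfl)

/-- The nodes other than a chosen representative of each component. -/
def nonRepresentatives [Fintype W] [Fintype B] (C : Set (Fin 4)) : Finset (W ⊕ B) := by
  classical
  exact Finset.univ.filter fun n => n ≠ (Quot.mk (G.JoinedBy C) n).out

theorem card_nonRepresentatives [Fintype W] [Fintype B] (C : Set (Fin 4)) :
    (G.nonRepresentatives C).card + G.numComponents C = Fintype.card (W ⊕ B) := by
  classical
  rw [nonRepresentatives, ← Finset.card_univ, add_comm,
    ← Finset.card_filter_add_card_filter_not (s := Finset.univ)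
      (fun n => n = (Quot.mk (G.JoinedBy C) n).out)]
  congr 1
  rw [numComponents, ← Set.ncard_univ, ← Set.ncard_coe_finset]
  refine Set.ncard_congr (fun q _ => q.out) ?_ ?_ ?_
  · intro q _
    simp [Quot.out_eq]
  · intro q q' _ _ h
    rw [← Quot.out_eq q, h, Quot.out_eq]
  · intro n hn
    exact ⟨Quot.mk _ n, Set.mem_univ _, (Finset.mem_filter.1 (Finset.mem_coe.1 hn)).2.symm⟩

/-- A set of nodes that contains no representative is left by some line. -/
theorem exists_exit [Fintype W] [Fintype B] (C : Set (Fin 4)) (S : Set (W ⊕ B))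
    (hS : S ⊆ G.nonRepresentatives C) (hne : S.Nonempty) :
    ∃ n ∈ S, ∃ c ∈ C, ∀ m ∈ S, m ≠ n → G.lineAt c m ≠ G.lineAt c n := by
  by_contra! hcon
  -- otherwise membership in `S` is constant on components
  have hinv : ∀ x y, G.JoinedBy C x y → (x ∈ S) = (y ∈ S) := by
    rintro x y ⟨c, hc, hxy⟩
    apply propext
    constructor
    · intro hx
      obtain ⟨m, hm, hmn, hl⟩ := hcon x hx c hc
      rcases (G.lineAt_eq_iff hxy m).1 hl with h | h
      · exact absurd h hmn
      · rwa [← h]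
    · intro hy
      obtain ⟨m, hm, hmn, hl⟩ := hcon y hy c hc
      rw [G.lineAt_eq_of_joined hxy] at hl
      rcases (G.lineAt_eq_iff hxy m).1 hl with h | h
      · rwa [← h]
      · exact absurd h hmn
  obtain ⟨n, hn⟩ := hne
  have hrep : Quot.lift (· ∈ S) hinv (Quot.mk _ ((Quot.mk (G.JoinedBy C) n).out)) := by
    rw [Quot.out_eq]
    exact hn
  have := hS hrep
  simp [nonRepresentatives, Quot.out_eq] at this

theorem numComponents_univ (hG : G.toSimpleGraph.Connected) : G.numComponents Set.univ = 1 := by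
  rw [numComponents, Nat.card_eq_one_iff_unique]
  obtain ⟨n0⟩ := hG.nonempty
  refine ⟨⟨?_⟩, ⟨Quot.mk _ n0⟩⟩
  rintro ⟨x⟩ ⟨y⟩
  obtain ⟨p⟩ := hG.preconnected x y
  induction p with
  | nil => rfl
  | cons h _ ih =>
    refine Eq.trans ?_ ih
    rw [toSimpleGraph, SimpleGraph.fromRel_adj] at h
    rcases h.2 with ⟨c, hc⟩ | ⟨c, hc⟩
    · exact Quot.sound ⟨c, Set.mem_univ _, hc⟩
    · exact (Quot.sound ⟨c, Set.mem_univ _, hc⟩).symm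

end ColouredGraph

/-! ### The integral of the weights at the nodes -/

/-- The word read around the vertex `v` of a tetrahedron, when the triangle of colour `l` has
holonomy `s l` at the vertex of the colour paired with `l` by `0 ↔ 2`, `1 ↔ 3`, then `g l`, then
`(s l * g l)⁻¹`. -/
def vertexWord (s g : Fin 4 → SU2) : Fin 4 → SU2 :=
  ![(s 1 * g 1)⁻¹ * s 2 * g 3, s 3 * g 2 * (s 0 * g 0)⁻¹, (s 3 * g 3)⁻¹ * s 0 * g 1,
    g 0 * (s 2 * g 2)⁻¹ * s 1]

/-- The holonomy around the rectangle that separates the edges `(0, 2)` and `(1, 3)` of a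
tetrahedron. -/
def squareWord (s : Fin 4 → SU2) : SU2 := (s 1)⁻¹ * s 2 * (s 3)⁻¹ * s 0

/-- The rectangle bounds the half of the octahedron facing the vertices `0` and `2`. -/
theorem distOne_squareWord_le (s g : Fin 4 → SU2) : distOne (squareWord s) ≤
    distOne (vertexWord s g 0) + distOne (vertexWord s g 2) := by
  have e : squareWord s = g 1 * (vertexWord s g 0 * vertexWord s g 2) * (g 1)⁻¹ := by
    simp [squareWord, vertexWord, mul_assoc]
  rw [e, distOne_conj]
  exact distOne_mul_le _ _

/-- The rectangle bounds the half of the octahedron facing the vertices `1` and `3`. -/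
theorem distOne_squareWord_le' (s g : Fin 4 → SU2) : distOne (squareWord s) ≤
    distOne (vertexWord s g 1) + distOne (vertexWord s g 3) := by
  have e : squareWord s = ((s 0)⁻¹ * vertexWord s g 1 * (s 0)⁻¹⁻¹ * vertexWord s g 3)⁻¹ := by
    simp [squareWord, vertexWord, mul_assoc]
  rw [e, distOne_inv, ← distOne_conj (vertexWord s g 1) (s 0)⁻¹]
  exact distOne_mul_le _ _

/-- The three factors attached to a tetrahedron: the weights of the vertices `0` and `2`, those of
the vertices `1` and `3`, and the weight of the rectangle. -/
def nodeFactor (r : ℝ) (s g : Fin 4 → SU2) : Fin 3 → ℝ≥0∞ :=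
  ![ENNReal.ofReal (weight r (vertexWord s g 0) + weight r (vertexWord s g 2)),
    ENNReal.ofReal (weight r (vertexWord s g 1) + weight r (vertexWord s g 3)),
    ENNReal.ofReal (weight r (squareWord s))]

theorem nodeFactor_zero (r : ℝ) (s g : Fin 4 → SU2) : nodeFactor r s g 0 =
    ENNReal.ofReal (weight r (vertexWord s g 0) + weight r (vertexWord s g 2)) := rfl

theorem nodeFactor_one (r : ℝ) (s g : Fin 4 → SU2) : nodeFactor r s g 1 =
    ENNReal.ofReal (weight r (vertexWord s g 1) + weight r (vertexWord s g 3)) := rfl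

theorem nodeFactor_two (r : ℝ) (s g : Fin 4 → SU2) : nodeFactor r s g 2 =
    ENNReal.ofReal (weight r (squareWord s)) := rfl

attribute [irreducible] nodeFactor

theorem nodeFactor_le_two (r : ℝ) (s g : Fin 4 → SU2) (i : Fin 3) : nodeFactor r s g i ≤ 2 := by
  have h : ∀ x : ℝ, x ≤ 2 → ENNReal.ofReal x ≤ 2 := fun x hx => by
    simpa using ENNReal.ofReal_le_ofReal hx
  have hw := weight_le_one r
  match i with
  | 0 =>
    rw [nodeFactor_zero]
    exact h _ (by linarith [hw (vertexWord s g 0), hw (vertexWord s g 2)])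
  | 1 =>
    rw [nodeFactor_one]
    exact h _ (by linarith [hw (vertexWord s g 1), hw (vertexWord s g 3)])
  | 2 =>
    rw [nodeFactor_two]
    exact h _ (by linarith [hw (squareWord s)])

theorem ofReal_four_mul_le {a b c d q : ℝ} (pa : 0 < a) (pb : 0 < b) (pc : 0 < c) (pd : 0 < d)
    (pq : 0 < q) (hq : q ≤ 1) (h1 : a * c ≤ 16 * q * (a + c)) (h2 : b * d ≤ 16 * q * (b + d)) :
    ENNReal.ofReal (a * b * c * d) ≤
      256 * (ENNReal.ofReal (a + c) * ENNReal.ofReal (b + d) * ENNReal.ofReal q) := by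
  have e : (256 : ℝ≥0∞) * (ENNReal.ofReal (a + c) * ENNReal.ofReal (b + d) * ENNReal.ofReal q) =
      ENNReal.ofReal (256 * ((a + c) * (b + d) * q)) := by
    rw [ENNReal.ofReal_mul (by norm_num), ENNReal.ofReal_mul (by positivity),
      ENNReal.ofReal_mul (by positivity)]
    norm_num
  rw [e]
  apply ENNReal.ofReal_le_ofReal
  calc a * b * c * d = (a * c) * (b * d) := by ring
    _ ≤ (16 * q * (a + c)) * (16 * q * (b + d)) := by gcongr
    _ = 256 * ((a + c) * (b + d) * q) * q := by ring
    _ ≤ 256 * ((a + c) * (b + d) * q) * 1 := by gcongr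
    _ = _ := mul_one _

/-- The two halves of the octahedron inscribed in the tetrahedron each produce the weight of the
rectangle between them; one of these two weights is dropped. -/
theorem prod_weight_vertexWord_le {r : ℝ} (hr : 0 < r) (s g : Fin 4 → SU2) :
    ENNReal.ofReal (∏ v, weight r (vertexWord s g v)) ≤ 256 * ∏ i, nodeFactor r s g i := by
  rw [Fin.prod_univ_four, Fin.prod_univ_three, nodeFactor_zero, nodeFactor_one, nodeFactor_two]
  exact ofReal_four_mul_le (weight_pos r _) (weight_pos r _) (weight_pos r _) (weight_pos r _)
    (weight_pos r _) (weight_le_one r _) (weight_mul_weight_le (distOne_squareWord_le s g) hr)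
    (weight_mul_weight_le (distOne_squareWord_le' s g) hr)

theorem lintegral_weight_mul_mul (r : ℝ) (a b : SU2) :
    ∫⁻ y, ENNReal.ofReal (weight r (a * y * b)) ∂haar =
      ∫⁻ y, ENNReal.ofReal (weight r y) ∂haar := by
  rw [← lintegral_mul_left_eq_self (fun y => ENNReal.ofReal (weight r y)) (b * a)]
  refine lintegral_congr fun y => ?_
  rw [weight_congr (distOne_mul_comm (a * y) b), mul_assoc]

theorem lintegral_weight_mul_inv_mul (r : ℝ) (a b : SU2) :
    ∫⁻ y, ENNReal.ofReal (weight r (a * y⁻¹ * b)) ∂haar =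
      ∫⁻ y, ENNReal.ofReal (weight r y) ∂haar := by
  rw [← lintegral_weight_mul_mul r b⁻¹ a⁻¹]
  refine lintegral_congr fun y => ?_
  rw [← weight_congr (distOne_inv (a * y⁻¹ * b))]
  simp [mul_assoc]

theorem lintegral_weight_add_le {r : ℝ} (hr : 0 < r) {f f' : SU2 → SU2} {a b a' b' : SU2}
    (hf : ∀ y, f y = a * y * b) (hf' : ∀ y, f' y = a' * y⁻¹ * b') :
    ∫⁻ y, ENNReal.ofReal (weight r (f y) + weight r (f' y)) ∂haar ≤
      2 * ∫⁻ y, ENNReal.ofReal (weight r y) ∂haar := by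
  have hm : Measurable fun y => ENNReal.ofReal (weight r (f y)) := by
    simp only [hf]
    exact ((continuous_weight hr).measurable.comp (by fun_prop)).ennreal_ofReal
  simp only [ENNReal.ofReal_add (weight_pos _ _).le (weight_pos _ _).le]
  rw [lintegral_add_left hm]
  simp only [hf, hf', lintegral_weight_mul_mul, lintegral_weight_mul_inv_mul]
  rw [two_mul]

/-- The colours of the lines whose variable can be used to integrate a factor: `g` for the first two
factors, `s` for the third. -/
def factorColours : Fin 3 → Set (Fin 4) := ![{1, 3}, {0, 2}, Set.univ]

theorem lintegral_nodeFactor_zero_le {r : ℝ} (hr : 0 < r) (s g : Fin 4 → SU2) {l : Fin 4}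
    (hl : l ∈ factorColours 0) : ∫⁻ y, nodeFactor r s (Function.update g l y) 0 ∂haar ≤
      2 * ∫⁻ y, ENNReal.ofReal (weight r y) ∂haar := by
  rcases hl with rfl | rfl
  · simp only [nodeFactor_zero, add_comm (weight r (vertexWord _ _ 0))]
    exact lintegral_weight_add_le hr (a := (s 3 * g 3)⁻¹ * s 0) (b := 1) (a' := 1)
      (b' := (s 1)⁻¹ * s 2 * g 3) (fun y => by simp [vertexWord])
      (fun y => by simp [vertexWord, mul_assoc])
  · simp only [nodeFactor_zero]
    exact lintegral_weight_add_le hr (a := (s 1 * g 1)⁻¹ * s 2) (b := 1) (a' := 1)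
      (b' := (s 3)⁻¹ * s 0 * g 1) (fun y => by simp [vertexWord])
      (fun y => by simp [vertexWord, mul_assoc])

theorem lintegral_nodeFactor_one_le {r : ℝ} (hr : 0 < r) (s g : Fin 4 → SU2) {l : Fin 4}
    (hl : l ∈ factorColours 1) : ∫⁻ y, nodeFactor r s (Function.update g l y) 1 ∂haar ≤
      2 * ∫⁻ y, ENNReal.ofReal (weight r y) ∂haar := by
  rcases hl with rfl | rfl
  · simp only [nodeFactor_one, add_comm (weight r (vertexWord _ _ 1))]
    exact lintegral_weight_add_le hr (a := 1) (b := (s 2 * g 2)⁻¹ * s 1) (a' := s 3 * g 2)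
      (b' := (s 0)⁻¹) (fun y => by simp [vertexWord, mul_assoc])
      (fun y => by simp [vertexWord, mul_assoc])
  · simp only [nodeFactor_one]
    exact lintegral_weight_add_le hr (a := s 3) (b := (s 0 * g 0)⁻¹) (a' := g 0)
      (b' := (s 2)⁻¹ * s 1) (fun y => by simp [vertexWord])
      (fun y => by simp [vertexWord, mul_assoc])

theorem lintegral_nodeFactor_two_le {r : ℝ} (s g : Fin 4 → SU2) (l : Fin 4) :
    ∫⁻ y, nodeFactor r (Function.update s l y) g 2 ∂haar ≤
      2 * ∫⁻ y, ENNReal.ofReal (weight r y) ∂haar := by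
  have h : ∫⁻ y, nodeFactor r (Function.update s l y) g 2 ∂haar =
      ∫⁻ y, ENNReal.ofReal (weight r y) ∂haar := by
    fin_cases l
    · rw [← lintegral_weight_mul_mul r ((s 1)⁻¹ * s 2 * (s 3)⁻¹) 1]
      simp [nodeFactor_two, squareWord]
    · rw [← lintegral_weight_mul_inv_mul r 1 (s 2 * (s 3)⁻¹ * s 0)]
      simp [nodeFactor_two, squareWord, mul_assoc]
    · rw [← lintegral_weight_mul_mul r (s 1)⁻¹ ((s 3)⁻¹ * s 0)]
      simp [nodeFactor_two, squareWord, mul_assoc]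
    · rw [← lintegral_weight_mul_inv_mul r ((s 1)⁻¹ * s 2) (s 0)]
      simp [nodeFactor_two, squareWord, mul_assoc]
  rw [h, two_mul]
  exact le_self_add

/-- The variables `g` that integrate the factors of the vertices `0`, `2` do not enter those of the
vertices `1`, `3`, so the former can be removed first. -/
theorem nodeFactor_one_update (r : ℝ) (s g : Fin 4 → SU2) {l : Fin 4} (hl : l ∈ factorColours 0)
    (y : SU2) : nodeFactor r s (Function.update g l y) 1 = nodeFactor r s g 1 := by
  rcases hl with rfl | rfl <;> simp [nodeFactor_one, vertexWord]

theorem nodeFactor_two_eq (r : ℝ) (s g g' : Fin 4 → SU2) :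
    nodeFactor r s g 2 = nodeFactor r s g' 2 := by
  rw [nodeFactor_two, nodeFactor_two]

theorem measurable_vertexWord {X : Type*} [MeasurableSpace X] {s g : X → Fin 4 → SU2}
    (hs : ∀ l, Measurable fun x => s x l) (hg : ∀ l, Measurable fun x => g x l) (v : Fin 4) :
    Measurable fun x => vertexWord (s x) (g x) v := by
  fin_cases v
  · exact ((((hs 1).mul (hg 1)).inv).mul (hs 2)).mul (hg 3)
  · exact ((hs 3).mul (hg 2)).mul (((hs 0).mul (hg 0)).inv)
  · exact ((((hs 3).mul (hg 3)).inv).mul (hs 0)).mul (hg 1)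
  · exact ((hg 0).mul (((hs 2).mul (hg 2)).inv)).mul (hs 1)

theorem measurable_nodeFactor {r : ℝ} (hr : 0 < r) {X : Type*} [MeasurableSpace X]
    {s g : X → Fin 4 → SU2} (hs : ∀ l, Measurable fun x => s x l)
    (hg : ∀ l, Measurable fun x => g x l) (i : Fin 3) :
    Measurable fun x => nodeFactor r (s x) (g x) i := by
  have hw := (continuous_weight hr).measurable
  have hv : ∀ v, Measurable fun x => weight r (vertexWord (s x) (g x) v) := fun v =>
    hw.comp (measurable_vertexWord hs hg v)
  have hq : Measurable fun x => weight r (squareWord (s x)) :=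
    hw.comp ((((hs 1).inv.mul (hs 2)).mul (hs 3).inv).mul (hs 0))
  match i with
  | 0 =>
    simp only [nodeFactor_zero]
    exact ((hv 0).add (hv 2)).ennreal_ofReal
  | 1 =>
    simp only [nodeFactor_one]
    exact ((hv 1).add (hv 3)).ennreal_ofReal
  | 2 =>
    simp only [nodeFactor_two]
    exact hq.ennreal_ofReal

namespace ColouredGraph

variable {W B : Type*} (G : ColouredGraph W B)

/-- The variables on the four lines at the node `n`, the colours being relabelled by `π`. -/
def atNode (π : Equiv.Perm (Fin 4)) (n : W ⊕ B) (x : Fin 4 × W → SU2) : Fin 4 → SU2 :=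
  fun l => x (π l, G.lineAt (π l) n)

theorem atNode_update_same [DecidableEq W] (π : Equiv.Perm (Fin 4)) (n : W ⊕ B)
    (x : Fin 4 × W → SU2) (l : Fin 4) (y : SU2) :
    G.atNode π n (Function.update x (π l, G.lineAt (π l) n) y) =
      Function.update (G.atNode π n x) l y := by
  funext k
  by_cases h : k = l
  · subst h
    simp [atNode]
  · rw [Function.update_of_ne h, atNode, Function.update_of_ne]
    · rfl
    · intro hc
      exact h (π.injective (Prod.ext_iff.1 hc).1)

theorem atNode_update_of_ne [DecidableEq W] (π : Equiv.Perm (Fin 4)) (n m : W ⊕ B)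
    (x : Fin 4 × W → SU2) (l : Fin 4) (y : SU2) (h : G.lineAt (π l) m ≠ G.lineAt (π l) n) :
    G.atNode π m (Function.update x (π l, G.lineAt (π l) n) y) = G.atNode π m x := by
  funext k
  rw [atNode, Function.update_of_ne]
  · rfl
  · intro hc
    have hk := π.injective (Prod.ext_iff.1 hc).1
    subst hk
    exact h (Prod.ext_iff.1 hc).2

/-- The integral of the factors at all nodes. The first two kinds of factors are integrated along
two families of faces, the third kind along the whole graph; one factor is lost in each
component. -/
theorem lintegral_prod_nodeFactor_le [Fintype W] [Fintype B] (π : Equiv.Perm (Fin 4)) {r : ℝ}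
    (hr : 0 < r) :
    ∫⁻ x : (Fin 4 × W) ⊕ (Fin 4 × W) → SU2,
      ∏ n : W ⊕ B, ∏ i, nodeFactor r (G.atNode π n fun f => x (Sum.inl f))
        (G.atNode π n fun f => x (Sum.inr f)) i ∂(Measure.pi fun _ => haar) ≤
    2 ^ (3 * Fintype.card (W ⊕ B)) *
      (2 * ∫⁻ y, ENNReal.ofReal (weight r y) ∂haar) ^
        ∑ i, (G.nonRepresentatives (π '' factorColours i)).card := by
  classical
  set c := 2 * ∫⁻ y, ENNReal.ofReal (weight r y) ∂haar with hc
  let S : Finset ((_ : Fin 3) × (W ⊕ B)) :=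
    Finset.univ.sigma fun i => G.nonRepresentatives (π '' factorColours i)
  let F : ((_ : Fin 3) × (W ⊕ B)) → ((Fin 4 × W) ⊕ (Fin 4 × W) → SU2) → ℝ≥0∞ :=
    fun d x => nodeFactor r (G.atNode π d.2 fun f => x (Sum.inl f))
      (G.atNode π d.2 fun f => x (Sum.inr f)) d.1
  have hFm : ∀ d, Measurable (F d) := fun d =>
    measurable_nodeFactor hr (fun l => measurable_pi_apply _) (fun l => measurable_pi_apply _) d.1
  have hcard : S.card = ∑ i, (G.nonRepresentatives (π '' factorColours i)).card :=
    Finset.card_sigma _ _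
  have hprod : ∀ x, ∏ n : W ⊕ B, ∏ i, nodeFactor r (G.atNode π n fun f => x (Sum.inl f))
      (G.atNode π n fun f => x (Sum.inr f)) i ≤
        2 ^ (3 * Fintype.card (W ⊕ B)) * ∏ d ∈ S, F d x := by
    intro x
    rw [Finset.prod_comm, ← Fintype.prod_sigma (fun d => F d x), ← Finset.prod_compl_mul_prod S]
    gcongr
    refine (Finset.prod_le_pow_card _ _ 2 fun d _ => nodeFactor_le_two _ _ _ _).trans ?_
    refine pow_le_pow_right₀ (by norm_num) ((Finset.card_le_univ _).trans (le_of_eq ?_))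
    simp
  have hmain := lintegral_prod_le_of_elimination haar F hFm c S (by
    intro S' hS' hne
    have hlayer : ∀ i : Fin 3, {n | (⟨i, n⟩ : (_ : Fin 3) × (W ⊕ B)) ∈ S'} ⊆
        G.nonRepresentatives (π '' factorColours i) := fun i n hn =>
      (Finset.mem_sigma.1 (hS' hn)).2
    have hexit : ∀ i : Fin 3, {n | (⟨i, n⟩ : (_ : Fin 3) × (W ⊕ B)) ∈ S'}.Nonempty →
        ∃ n, (⟨i, n⟩ : (_ : Fin 3) × (W ⊕ B)) ∈ S' ∧ ∃ l ∈ factorColours i,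
          ∀ m, (⟨i, m⟩ : (_ : Fin 3) × (W ⊕ B)) ∈ S' → m ≠ n →
            G.lineAt (π l) m ≠ G.lineAt (π l) n := by
      intro i hi
      obtain ⟨n, hn, k, ⟨l, hl, rfl⟩, h⟩ := G.exists_exit _ _ (hlayer i) hi
      exact ⟨n, hn, l, hl, h⟩
    have hgg : ∀ (x : (Fin 4 × W) ⊕ (Fin 4 × W) → SU2) e y,
        (fun f => Function.update x (Sum.inr e) y (Sum.inr f)) =
          Function.update (fun f => x (Sum.inr f)) e y := fun x e y =>
      Function.update_comp_eq_of_injective x Sum.inr_injective e y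
    have hgs : ∀ (x : (Fin 4 × W) ⊕ (Fin 4 × W) → SU2) e y,
        (fun f => Function.update x (Sum.inr e) y (Sum.inl f)) = fun f => x (Sum.inl f) :=
      fun x e y => funext fun f => by simp
    have hss : ∀ (x : (Fin 4 × W) ⊕ (Fin 4 × W) → SU2) e y,
        (fun f => Function.update x (Sum.inl e) y (Sum.inl f)) =
          Function.update (fun f => x (Sum.inl f)) e y := fun x e y =>
      Function.update_comp_eq_of_injective x Sum.inl_injective e y
    have hsg : ∀ (x : (Fin 4 × W) ⊕ (Fin 4 × W) → SU2) e y,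
        (fun f => Function.update x (Sum.inl e) y (Sum.inr f)) = fun f => x (Sum.inr f) :=
      fun x e y => funext fun f => by simp
    by_cases h0 : {n | (⟨0, n⟩ : (_ : Fin 3) × (W ⊕ B)) ∈ S'}.Nonempty
    · obtain ⟨n, hn, l, hl, h⟩ := hexit 0 h0
      refine ⟨⟨0, n⟩, hn, Sum.inr (π l, G.lineAt (π l) n), ?_, fun x => ?_⟩
      · rintro ⟨i, m⟩ hm hne x y
        simp only [F, hgg, hgs]
        by_cases hmn : G.lineAt (π l) m = G.lineAt (π l) n
        · rw [← hmn, atNode_update_same]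
          fin_cases i
          · exact absurd hmn (h m hm fun e => hne (by rw [e]; rfl))
          · exact nodeFactor_one_update r _ _ hl y
          · exact nodeFactor_two_eq r _ _ _
        · rw [atNode_update_of_ne _ _ _ _ _ _ _ hmn]
      · simp only [F, hgg, hgs, atNode_update_same]
        exact lintegral_nodeFactor_zero_le hr _ _ hl
    by_cases h1 : {n | (⟨1, n⟩ : (_ : Fin 3) × (W ⊕ B)) ∈ S'}.Nonempty
    · obtain ⟨n, hn, l, hl, h⟩ := hexit 1 h1
      refine ⟨⟨1, n⟩, hn, Sum.inr (π l, G.lineAt (π l) n), ?_, fun x => ?_⟩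
      · rintro ⟨i, m⟩ hm hne x y
        simp only [F, hgg, hgs]
        by_cases hmn : G.lineAt (π l) m = G.lineAt (π l) n
        · rw [← hmn, atNode_update_same]
          fin_cases i
          · exact absurd ⟨m, hm⟩ h0
          · exact absurd hmn (h m hm fun e => hne (by rw [e]; rfl))
          · exact nodeFactor_two_eq r _ _ _
        · rw [atNode_update_of_ne _ _ _ _ _ _ _ hmn]
      · simp only [F, hgg, hgs, atNode_update_same]
        exact lintegral_nodeFactor_one_le hr _ _ hl
    have h2 : {n | (⟨2, n⟩ : (_ : Fin 3) × (W ⊕ B)) ∈ S'}.Nonempty := by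
      obtain ⟨⟨i, m⟩, hm⟩ := hne
      fin_cases i
      · exact absurd ⟨m, hm⟩ h0
      · exact absurd ⟨m, hm⟩ h1
      · exact ⟨m, hm⟩
    obtain ⟨n, hn, l, -, h⟩ := hexit 2 h2
    refine ⟨⟨2, n⟩, hn, Sum.inl (π l, G.lineAt (π l) n), ?_, fun x => ?_⟩
    · rintro ⟨i, m⟩ hm hne x y
      fin_cases i
      · exact absurd ⟨m, hm⟩ h0
      · exact absurd ⟨m, hm⟩ h1
      · simp only [F, hss]
        rw [atNode_update_of_ne _ _ _ _ _ _ _ (h m hm fun e => hne (by rw [e]; rfl))]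
        exact nodeFactor_two_eq r _ _ _
    · simp only [F, hss, hsg, atNode_update_same]
      exact lintegral_nodeFactor_two_le _ _ l)
  calc _ ≤ ∫⁻ x : (Fin 4 × W) ⊕ (Fin 4 × W) → SU2,
        2 ^ (3 * Fintype.card (W ⊕ B)) * ∏ d ∈ S, F d x ∂(Measure.pi fun _ => haar) :=
        lintegral_mono hprod
    _ = 2 ^ (3 * Fintype.card (W ⊕ B)) *
        ∫⁻ x : (Fin 4 × W) ⊕ (Fin 4 × W) → SU2, ∏ d ∈ S, F d x ∂(Measure.pi fun _ => haar) :=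
        lintegral_const_mul _ (Finset.measurable_prod _ fun d _ => hFm d)
    _ ≤ _ := by
        rw [← hcard]
        gcongr

end ColouredGraph

/-! ### Bounds on amplitudes -/

/-- Cyclic rotation of the holonomies `(x, y, (x y)⁻¹)` of a triangle. -/
def rotate (p : SU2 × SU2) : SU2 × SU2 := (p.2, (p.1 * p.2)⁻¹)

/-- Relabellings of the colours that carry the pairing `0 ↔ 2`, `1 ↔ 3` to the three pairings. -/
def relabel : Fin 3 → Equiv.Perm (Fin 4) :=
  ![1, Equiv.swap 1 2 * Equiv.swap 2 3, Equiv.swap 2 3 * Equiv.swap 1 2]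

/-- The number of rotations that bring to the first place the holonomy of the triangle of colour
`l` at the vertex of the colour paired with `l`. -/
def shift : Fin 3 → Fin 4 → ℕ := ![![2, 0, 2, 1], ![1, 2, 1, 0], ![0, 1, 0, 2]]

/-- The holonomies of a triangle of colour `l`, parametrised by the holonomy at the vertex of the
colour paired with `l` and by the next one in cyclic order. -/
def lineParam (k : Fin 3) (l : Fin 4) (p : SU2 × SU2) : Fin 4 → SU2 :=
  triangleHolonomy l (rotate^[shift k l] p)

theorem measurable_triangleHolonomy (l : Fin 4) : Measurable (triangleHolonomy l) := by
  refine measurable_pi_lambda _ fun v => ?_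
  unfold triangleHolonomy
  split_ifs
  · exact measurable_fst
  · exact measurable_snd
  · exact (measurable_fst.mul measurable_snd).inv
  · exact measurable_const

theorem measurePreserving_rotate_iterate (n : ℕ) :
    MeasurePreserving rotate^[n] (haar.prod haar) (haar.prod haar) :=
  MeasurePreserving.iterate measurePreserving_rotate n

theorem measurable_lineParam (k : Fin 3) (l : Fin 4) : Measurable (lineParam k l) :=
  (measurable_triangleHolonomy l).comp (measurePreserving_rotate_iterate _).measurable

theorem map_lineParam (k : Fin 3) (l : Fin 4) :
    (haar.prod haar).map (lineParam k l) = lineMeasure l := by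
  have h := measurePreserving_rotate_iterate (shift k l)
  change Measure.map (triangleHolonomy l ∘ rotate^[shift k l]) _ = _
  rw [← Measure.map_map (measurable_triangleHolonomy l) h.measurable, h.map_eq, lineMeasure]

theorem distOne_rotate (a b c d : SU2) :
    distOne (a * (b * (c * d))) = distOne (b * (c * (d * a))) := by
  rw [distOne_mul_comm]
  simp only [mul_assoc]

/-- Up to cyclic rotation, the flatness condition at a vertex is the word `vertexWord`. -/
theorem distOne_vertexHolonomy (k : Fin 3) (v : Fin 4) (p : Fin 4 → SU2 × SU2) :
    distOne (lineParam k (order (relabel k v) 0) (p (order (relabel k v) 0)) (relabel k v) *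
      lineParam k (order (relabel k v) 1) (p (order (relabel k v) 1)) (relabel k v) *
      lineParam k (order (relabel k v) 2) (p (order (relabel k v) 2)) (relabel k v)) =
    distOne (vertexWord (fun l => (p (relabel k l)).1) (fun l => (p (relabel k l)).2) v) := by
  have r2 : ∀ p : SU2 × SU2, rotate^[2] p = ((p.1 * p.2)⁻¹, p.1) := fun p => by
    simp [rotate]
  -- the two sides differ by a rotation of four letters
  fin_cases k <;> fin_cases v <;>
    simp [lineParam, relabel, shift, order, triangleHolonomy, vertexWord, rotate, r2,
      Equiv.swap_apply_def, mul_assoc]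
  all_goals
    first
    | exact distOne_rotate _ _ _ _
    | exact (distOne_rotate _ _ _ _).trans (distOne_rotate _ _ _ _)
    | exact (distOne_rotate _ _ _ _).symm

theorem heatKernel_one_pos {r : ℝ} (hr : 0 < r) (hr1 : r ≤ 1) : 0 < heatKernel (r ^ 2) 1 :=
  lt_of_lt_of_le (by positivity) (le_heatKernel_one hr hr1)

/-- Changing variables on all lines of a graph. -/
theorem lintegral_pi_lineMeasure_le {W : Type*} [Fintype W] (k : Fin 3)
    (f : (Fin 4 × W → Fin 4 → SU2) → ℝ≥0∞) :
    ∫⁻ x, f x ∂(Measure.pi fun e : Fin 4 × W => lineMeasure e.1) ≤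
      ∫⁻ x : (Fin 4 × W) ⊕ (Fin 4 × W) → SU2,
        f (fun e => lineParam k e.1 (x (Sum.inl e), x (Sum.inr e)))
        ∂(Measure.pi fun _ => haar) := by
  have h1 : (Measure.pi fun e : Fin 4 × W => lineMeasure e.1) =
      (Measure.pi fun _ : Fin 4 × W => haar.prod haar).map
        (fun x e => lineParam k e.1 (x e)) := by
    have hp : ∀ e : Fin 4 × W,
        IsProbabilityMeasure ((haar.prod haar).map (lineParam k e.1)) := fun e =>
      Measure.isProbabilityMeasure_map (measurable_lineParam k e.1).aemeasurable
    rw [Measure.pi_map_pi (f := fun e : Fin 4 × W => lineParam k e.1)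
      fun e => (measurable_lineParam k e.1).aemeasurable]
    simp only [map_lineParam]
  have h2 : MeasurePreserving
      (fun (x : (Fin 4 × W) ⊕ (Fin 4 × W) → SU2) e => (x (Sum.inl e), x (Sum.inr e)))
      (Measure.pi fun _ => haar) (Measure.pi fun _ : Fin 4 × W => haar.prod haar) :=
    ((measurePreserving_arrowProdEquivProdArrow SU2 SU2 (Fin 4 × W) (fun _ => haar)
      fun _ => haar).symm _).comp
      (measurePreserving_sumPiEquivProdPi fun _ : (Fin 4 × W) ⊕ (Fin 4 × W) => haar)
  rw [h1]
  refine (lintegral_map_le _ _).trans ?_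
  rw [← h2.map_eq]
  exact lintegral_map_le _ _

/-- The constant in the bound of the heat kernel by the weight. -/
def heatConst : ℝ := 11670 * 20 ^ 5

theorem heatConst_pos : 0 < heatConst := by norm_num [heatConst]

theorem enorm_interaction_le {r : ℝ} (hr : 0 < r) (hr1 : r ≤ 1) (k : Fin 3)
    (s g : Fin 4 → SU2) :
    ‖interaction (r ^ 2) (fun l => lineParam k l (s l, g l))‖ₑ ≤
      ENNReal.ofReal (256 * ((heatConst / r ^ 3) ^ 4 / heatKernel (r ^ 2) 1)) *
        ∏ i, nodeFactor r (fun l => s (relabel k l)) (fun l => g (relabel k l)) i := by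
  have hD := heatKernel_one_pos hr hr1
  have hC := heatConst_pos
  have h1 : |interaction (r ^ 2) (fun l => lineParam k l (s l, g l))| ≤
      ((heatConst / r ^ 3) ^ 4 / heatKernel (r ^ 2) 1) *
        ∏ v, weight r (vertexWord (fun l => s (relabel k l)) (fun l => g (relabel k l)) v) := by
    rw [interaction, abs_div, abs_of_pos hD, div_mul_eq_mul_div]
    gcongr
    rw [Finset.abs_prod, ← Equiv.prod_comp (relabel k)]
    have : (heatConst / r ^ 3) ^ 4 = ∏ _v : Fin 4, heatConst / r ^ 3 := by
      rw [Finset.prod_const, Finset.card_univ, Fintype.card_fin]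
    rw [this, ← Finset.prod_mul_distrib]
    refine Finset.prod_le_prod (fun v _ => abs_nonneg _) fun v _ => ?_
    refine (abs_heatKernel_le_weight hr hr1 _).trans (le_of_eq ?_)
    rw [weight_congr (distOne_vertexHolonomy k v fun l => (s l, g l))]
    rfl
  rw [Real.enorm_eq_ofReal_abs]
  refine (ENNReal.ofReal_le_ofReal h1).trans ?_
  rw [ENNReal.ofReal_mul (by positivity), ENNReal.ofReal_mul (by norm_num)]
  refine (mul_le_mul_right (prod_weight_vertexWord_le hr _ _) _).trans (le_of_eq ?_)
  rw [← mul_assoc, mul_comm (ENNReal.ofReal _) 256]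
  norm_num

namespace ColouredGraph

variable {W B : Type*} [Fintype W] [Fintype B] (G : ColouredGraph W B)

/-- The exponent of the bound attached to a pairing of the colours: faces of the two kinds that the
pairing selects, plus the number of components of the graph. -/
def pairingExponent (k : Fin 3) : ℕ := ∑ i, G.numComponents (relabel k '' factorColours i)

theorem sum_card_nonRepresentatives (k : Fin 3) :
    (∑ i, (G.nonRepresentatives (relabel k '' factorColours i)).card) + G.pairingExponent k =
      3 * Fintype.card (W ⊕ B) := by
  rw [pairingExponent, ← Finset.sum_add_distrib]
  simp only [card_nonRepresentatives, Finset.sum_const, Finset.card_univ, Fintype.card_fin,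
    smul_eq_mul]

/-- The integral in the amplitude, before any rescaling. -/
def feynmanIntegral (t : ℝ) : ℝ :=
  ∫ x : Fin 4 × W → Fin 4 → SU2,
      ∏ n : W ⊕ B, interaction t (fun l v => x (l, G.lineAt l n) v)
      ∂(Measure.pi fun f : Fin 4 × W => lineMeasure f.1)

theorem abs_feynmanIntegral_le (k : Fin 3) {r : ℝ} (hr : 0 < r) (hr1 : r ≤ 1) :
    |G.feynmanIntegral (r ^ 2)| ≤
      (256 * ((heatConst / r ^ 3) ^ 4 / heatKernel (r ^ 2) 1)) ^ Fintype.card (W ⊕ B) *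
        (2 ^ (3 * Fintype.card (W ⊕ B)) * (32768 * r ^ 3) ^
          ∑ i, (G.nonRepresentatives (relabel k '' factorColours i)).card) := by
  have hD := heatKernel_one_pos hr hr1
  have hC := heatConst_pos
  rw [← ENNReal.ofReal_le_ofReal_iff (by positivity), ← Real.enorm_eq_ofReal_abs, feynmanIntegral]
  refine (enorm_integral_le_lintegral_enorm _).trans ((lintegral_pi_lineMeasure_le k _).trans ?_)
  set K := ENNReal.ofReal (256 * ((heatConst / r ^ 3) ^ 4 / heatKernel (r ^ 2) 1)) with hK
  have hpt : ∀ x : (Fin 4 × W) ⊕ (Fin 4 × W) → SU2,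
      ‖∏ n : W ⊕ B, interaction (r ^ 2) (fun l v =>
        lineParam k l (x (Sum.inl (l, G.lineAt l n)), x (Sum.inr (l, G.lineAt l n))) v)‖ₑ ≤
      K ^ Fintype.card (W ⊕ B) *
        ∏ n : W ⊕ B, ∏ i, nodeFactor r (G.atNode (relabel k) n fun f => x (Sum.inl f))
        (G.atNode (relabel k) n fun f => x (Sum.inr f)) i := by
    intro x
    have e : ∀ n : W ⊕ B, _ := fun n => enorm_interaction_le hr hr1 k
      (fun l => x (Sum.inl (l, G.lineAt l n))) (fun l => x (Sum.inr (l, G.lineAt l n)))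
    have hprod : ∀ f : W ⊕ B → ℝ, ‖∏ n, f n‖ₑ = ∏ n, ‖f n‖ₑ := fun f => by
      simp only [Real.enorm_eq_ofReal_abs, Finset.abs_prod]
      exact ENNReal.ofReal_prod_of_nonneg fun _ _ => abs_nonneg _
    rw [hprod, Finset.card_univ.symm, ← Finset.prod_const, ← Finset.prod_mul_distrib]
    exact Finset.prod_le_prod' fun n _ => e n
  have hbase : 2 * ∫⁻ y, ENNReal.ofReal (weight r y) ∂haar ≤ ENNReal.ofReal (32768 * r ^ 3) := by
    refine (mul_le_mul_right (lintegral_weight_le hr) 2).trans (le_of_eq ?_)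
    rw [show (32768 * r ^ 3 : ℝ) = 2 * (16384 * r ^ 3) by ring,
      ENNReal.ofReal_mul (by norm_num : (0 : ℝ) ≤ 2)]
    norm_num
  have hKtop : K ^ Fintype.card (W ⊕ B) ≠ ∞ := ENNReal.pow_ne_top ENNReal.ofReal_ne_top
  refine (lintegral_mono hpt).trans ?_
  rw [lintegral_const_mul' _ _ hKtop, ENNReal.ofReal_mul (by positivity),
    ENNReal.ofReal_mul (by positivity), ENNReal.ofReal_pow (by positivity),
    ENNReal.ofReal_pow (by positivity), ENNReal.ofReal_pow (by positivity)]
  gcongr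
  refine (G.lintegral_prod_nodeFactor_le (relabel k) hr).trans ?_
  rw [show ENNReal.ofReal 2 = 2 by norm_num]
  gcongr

/-- The integral is at most of order `δ_t(1)` to the power `pairingExponent`. -/
theorem exists_abs_feynmanIntegral_le (k : Fin 3) : ∃ C : ℝ, 0 ≤ C ∧ ∀ r : ℝ, 0 < r → r ≤ 1 →
    |G.feynmanIntegral (r ^ 2)| ≤ C * heatKernel (r ^ 2) 1 ^ G.pairingExponent k := by
  have hsum := G.sum_card_nonRepresentatives k
  set N := Fintype.card (W ⊕ B) with hN
  set K := ∑ i, (G.nonRepresentatives (relabel k '' factorColours i)).card with hK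
  set m := G.pairingExponent k with hm
  have hC := heatConst_pos
  refine ⟨(256 * heatConst ^ 4) ^ N * 2 ^ (3 * N) * 32768 ^ K * 9 ^ (m + N), by positivity,
    fun r hr hr1 => (G.abs_feynmanIntegral_le k hr hr1).trans ?_⟩
  have hD := heatKernel_one_pos hr hr1
  have hDr := le_heatKernel_one hr hr1
  set D := heatKernel (r ^ 2) 1 with hDdef
  have h9 : 1 / r ^ 3 ≤ 9 * D := by
    have : 1 / r ^ 3 = 9 * (1 / 9 / r ^ 3) := by ring
    rw [this]
    gcongr
  -- power counting: `4 N = K + (m + N)`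
  have hpow : (1 / r ^ 3) ^ (4 * N) * (r ^ 3) ^ K = (1 / r ^ 3) ^ (m + N) := by
    have : 4 * N = m + N + K := by omega
    rw [this, pow_add, mul_assoc, ← mul_pow, one_div_mul_cancel (by positivity), one_pow, mul_one]
  calc (256 * ((heatConst / r ^ 3) ^ 4 / D)) ^ N * (2 ^ (3 * N) * (32768 * r ^ 3) ^ K)
      = (256 * heatConst ^ 4) ^ N * 2 ^ (3 * N) * 32768 ^ K *
          (((1 / r ^ 3) ^ (4 * N) * (r ^ 3) ^ K) * (1 / D) ^ N) := by
        have e : 256 * ((heatConst / r ^ 3) ^ 4 / D) =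
            256 * heatConst ^ 4 * (1 / r ^ 3) ^ 4 * (1 / D) := by ring
        rw [e, mul_pow _ (1 / D), mul_pow _ ((1 / r ^ 3) ^ 4), ← pow_mul (1 / r ^ 3) 4 N,
          mul_pow 32768]
        ring
    _ ≤ (256 * heatConst ^ 4) ^ N * 2 ^ (3 * N) * 32768 ^ K *
          ((9 * D) ^ (m + N) * (1 / D) ^ N) := by
        rw [hpow]
        gcongr
    _ = _ := by
        have : D ^ N * (1 / D) ^ N = 1 := by
          rw [← mul_pow, mul_one_div_cancel hD.ne', one_pow]
        calc _ = (256 * heatConst ^ 4) ^ N * 2 ^ (3 * N) * 32768 ^ K * 9 ^ (m + N) *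
              D ^ m * (D ^ N * (1 / D) ^ N) := by
              rw [mul_pow 9 D, pow_add D]
              ring
          _ = _ := by rw [this, mul_one]

end ColouredGraph

theorem tendsto_heatKernel_one : Tendsto (fun t : ℝ => heatKernel t 1) (𝓝[>] 0) atTop := by
  have h1 : Tendsto (fun t : ℝ => 1 / 9 * (Real.sqrt t ^ 3)⁻¹) (𝓝[>] 0) atTop := by
    refine Tendsto.const_mul_atTop (by norm_num) (Tendsto.inv_tendsto_nhdsGT_zero ?_)
    refine tendsto_nhdsWithin_iff.2 ⟨?_, ?_⟩
    · have : Continuous fun t : ℝ => Real.sqrt t ^ 3 := by fun_prop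
      have h := this.tendsto 0
      simp only [Real.sqrt_zero] at h
      norm_num at h
      exact h.mono_left nhdsWithin_le_nhds
    · filter_upwards [self_mem_nhdsWithin] with t ht
      have := Real.sqrt_pos.2 ht
      exact pow_pos this 3
  refine tendsto_atTop_mono' _ ?_ h1
  filter_upwards [self_mem_nhdsWithin, Ioo_mem_nhdsGT (zero_lt_one (α := ℝ))] with t ht ht1
  have h2 := le_heatKernel_one (Real.sqrt_pos.2 ht) (Real.sqrt_le_one.2 ht1.2.le)
  rw [Real.sq_sqrt (le_of_lt ht)] at h2
  rwa [div_eq_mul_inv] at h2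

/-- Power counting for a pairing of the colours. -/
theorem divergenceDegree_le_pairingExponent {W B : Type*} [Fintype W] [Fintype B]
    (G : ColouredGraph W B) (lam : ℂ) (k : Fin 3) :
    divergenceDegree (rescaledAmplitude G lam) ≤
      (((G.pairingExponent k : ℝ) - Fintype.card W : ℝ) : EReal) := by
  obtain ⟨C, hC, hbound⟩ := G.exists_abs_feynmanIntegral_le k
  rw [← EReal.le_of_forall_lt_iff_le]
  intro γ hγ
  have hγ' : (G.pairingExponent k : ℝ) - Fintype.card W < γ := by exact_mod_cast hγ
  refine sInf_le ⟨γ, ⟨0, ?_⟩, rfl⟩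
  set m := G.pairingExponent k
  set w := Fintype.card W with hw
  have hlim : Tendsto (fun t : ℝ => Complex.normSq lam ^ w * C *
      heatKernel t 1 ^ (-(γ - (m - w)))) (𝓝[>] 0) (𝓝 0) := by
    have := (tendsto_rpow_neg_atTop (sub_pos.2 hγ')).comp tendsto_heatKernel_one
    simpa using this.const_mul (Complex.normSq lam ^ w * C)
  refine squeeze_zero_norm' ?_ hlim
  filter_upwards [self_mem_nhdsWithin, Ioo_mem_nhdsGT (zero_lt_one (α := ℝ))] with t ht ht1
  have hr := Real.sqrt_pos.2 ht
  have hr1 := Real.sqrt_le_one.2 ht1.2.le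
  have hb := hbound _ hr hr1
  have hD := heatKernel_one_pos hr hr1
  rw [Real.sq_sqrt (le_of_lt ht)] at hb hD
  set D := heatKernel t 1
  have hA : rescaledAmplitude G lam t = (Complex.normSq lam / D) ^ w * G.feynmanIntegral t := by
    have e : Complex.normSq (lam / (Real.sqrt D : ℂ)) = Complex.normSq lam / D := by
      rw [Complex.normSq_div, Complex.normSq_ofReal, Real.mul_self_sqrt hD.le]
    rw [rescaledAmplitude, amplitude, e]
    rfl
  rw [Real.norm_eq_abs, abs_mul, abs_of_pos (Real.rpow_pos_of_pos hD _), hA, abs_mul,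
    abs_of_nonneg (pow_nonneg (div_nonneg (Complex.normSq_nonneg _) hD.le) _)]
  have hq := Complex.normSq_nonneg lam
  calc D ^ (-γ) * ((Complex.normSq lam / D) ^ w * |G.feynmanIntegral t|)
      ≤ D ^ (-γ) * ((Complex.normSq lam / D) ^ w * (C * D ^ m)) := by gcongr
    _ = Complex.normSq lam ^ w * C * D ^ (-(γ - (m - w))) := by
      have e : D ^ (-(γ - ((m : ℝ) - w))) = D ^ (-γ) * D ^ m / D ^ w := by
        rw [show -(γ - ((m : ℝ) - w)) = -γ + m - w by ring, Real.rpow_sub hD, Real.rpow_add hD,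
          Real.rpow_natCast, Real.rpow_natCast]
      rw [e, div_pow]
      ring

/-! ### Combinatorics of jackets -/

/-- The quotient by a relation that preserves a label splits according to the label. -/
def quotProdEquivSigma {X I : Type*} (R : I → X → X → Prop) (r : X × I → X × I → Prop)
    (h : ∀ p q, r p q ↔ p.2 = q.2 ∧ R p.2 p.1 q.1) : Quot r ≃ Σ i, Quot (R i) where
  toFun := Quot.lift (fun p => ⟨p.2, Quot.mk _ p.1⟩) (by
    rintro ⟨x, i⟩ ⟨y, j⟩ hr
    obtain ⟨rfl, hR⟩ := (h _ _).1 hr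
    exact congrArg (Sigma.mk i) (Quot.sound hR))
  invFun p := Quot.lift (fun x => Quot.mk r (x, p.1))
    (fun x y hR => Quot.sound ((h _ _).2 ⟨rfl, hR⟩)) p.2
  left_inv := by
    rintro ⟨p⟩
    rfl
  right_inv := by
    rintro ⟨i, ⟨x⟩⟩
    rfl

section Counting

variable {W B : Type*} (G : ColouredGraph W B)

theorem card_jacketVertex [Fintype W] [Fintype B] (σ : Equiv.Perm (Fin 4)) :
    Nat.card (JacketVertex G σ) = ∑ c, G.numComponents {c, σ c} := by
  have e := Nat.card_congr (quotProdEquivSigma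
    (fun c => G.JoinedBy {σ⁻¹ (σ⁻¹ c), σ⁻¹ c}) (CornerGlue G σ) (by
      rintro ⟨x, c⟩ ⟨y, d⟩
      constructor
      · rintro ⟨k, h1, h2, h3 | h3⟩
        · exact ⟨h2, _, Or.inr rfl, by simpa [show c = k from h3] using h1⟩
        · exact ⟨h2, _, Or.inl rfl, by simpa [show c = σ k from h3] using h1⟩
      · rintro ⟨h2, k, rfl | rfl, h1⟩
        · exact ⟨σ⁻¹ c, h1, h2, Or.inr (by simp)⟩
        · exact ⟨c, h1, h2, Or.inl rfl⟩))
  rw [JacketVertex, e, Nat.card_sigma, ← Equiv.sum_comp (σ * σ)]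
  refine Finset.sum_congr rfl fun c _ => ?_
  simp [ColouredGraph.numComponents]

theorem card_quot_joined [Fintype W] (c : Fin 4) :
    Nat.card (Quot (G.Joined c)) = Fintype.card W := by
  rw [← Nat.card_eq_fintype_card]
  refine Nat.card_congr
    { toFun := Quot.lift (G.lineAt c) fun x y h => (G.lineAt_eq_of_joined h).symm
      invFun := fun w => Quot.mk _ (Sum.inl w)
      left_inv := ?_
      right_inv := fun w => rfl }
  rintro ⟨w | b⟩
  · rfl
  · exact Quot.sound ⟨_, rfl, by simp [ColouredGraph.lineAt]⟩

theorem card_jacketEdge [Fintype W] [Fintype B] (σ : Equiv.Perm (Fin 4)) :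
    Nat.card (JacketEdge G σ) = 4 * Fintype.card W := by
  have e := Nat.card_congr (quotProdEquivSigma
    (fun c => G.Joined (σ⁻¹ c)) (SideGlue G σ) (fun p q => and_comm))
  rw [JacketEdge, e, Nat.card_sigma]
  simp [card_quot_joined]

theorem card_jacketFace [Fintype W] [Fintype B] (σ : Equiv.Perm (Fin 4)) :
    Nat.card (JacketFace G σ) = 2 * Fintype.card W := by
  rw [Nat.card_eq_fintype_card, Fintype.card_sum, ← Fintype.card_congr (G.line 0)]
  ring

theorem eulerChar_eq [Fintype W] [Fintype B] (σ : Equiv.Perm (Fin 4)) : eulerChar G σ =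
    (∑ c, G.numComponents {c, σ c} : ℕ) - 2 * (Fintype.card W : ℤ) := by
  rw [eulerChar, card_jacketVertex, card_jacketEdge, card_jacketFace]
  push_cast
  ring

/-- The permutations `relabel k` realise every pairing of the four colours. -/
theorem exists_pairing : ∀ a b c d : Fin 4, [a, b, c, d].Nodup → ∃ k : Fin 3,
    (({relabel k 1, relabel k 3} : Finset (Fin 4)) = {a, b} ∧
      ({relabel k 0, relabel k 2} : Finset (Fin 4)) = {c, d}) ∨
    (({relabel k 1, relabel k 3} : Finset (Fin 4)) = {c, d} ∧
      ({relabel k 0, relabel k 2} : Finset (Fin 4)) = {a, b}) := by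
  decide

theorem exists_pairingExponent_eq (hG : G.toSimpleGraph.Connected) {a b c d : Fin 4}
    (h : [a, b, c, d].Nodup) : ∃ k, G.pairingExponent k =
      G.numComponents {a, b} + G.numComponents {c, d} + 1 := by
  obtain ⟨k, hk⟩ := exists_pairing a b c d h
  refine ⟨k, ?_⟩
  have h0 : relabel k '' factorColours 0 = {relabel k 1, relabel k 3} :=
    Set.image_pair _ _ _
  have h1 : relabel k '' factorColours 1 = {relabel k 0, relabel k 2} :=
    Set.image_pair _ _ _
  have h2 : relabel k '' factorColours 2 = Set.univ :=
    Set.image_univ_of_surjective (relabel k).surjective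
  rw [ColouredGraph.pairingExponent, Fin.sum_univ_three, h0, h1, h2, G.numComponents_univ hG]
  have hc : ∀ {x y z w : Fin 4}, ({x, y} : Finset (Fin 4)) = {z, w} →
      ({x, y} : Set (Fin 4)) = {z, w} := fun {x y z w} e => by
    rw [← Finset.coe_pair, e, Finset.coe_pair]
  rcases hk with ⟨e1, e2⟩ | ⟨e1, e2⟩
  · rw [hc e1, hc e2]
  · rw [hc e1, hc e2, add_comm (G.numComponents {c, d})]

theorem nodup_orbit (σ : ColourCycle) (c : Fin 4) :
    [c, σ.1 c, σ.1 (σ.1 c), σ.1 (σ.1 (σ.1 c))].Nodup := by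
  have h4 := iterate_four σ.1 σ.2.1 σ.2.2
  have h1 : ∀ x, σ.1 x ≠ x := fun x => by
    rw [← Equiv.Perm.mem_support, σ.2.2]
    exact Finset.mem_univ x
  have h2 : ∀ x, σ.1 (σ.1 x) ≠ x := by
    intro x hx
    have h : σ.1 ^ 2 = 1 := σ.2.1.pow_eq_one_iff.2 ⟨x, h1 x, by simpa [pow_two] using hx⟩
    have ho : orderOf σ.1 = 4 := by
      rw [σ.2.1.orderOf, σ.2.2]
      rfl
    have := Nat.le_of_dvd two_pos (orderOf_dvd_of_pow_eq_one h)
    omega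
  have h3 : ∀ x, σ.1 (σ.1 (σ.1 x)) ≠ x := fun x hx => by
    have := h4 x
    rw [hx] at this
    exact h1 x this
  simp [(h1 _).symm, (h2 _).symm, (h3 _).symm]

theorem sum_eq_of_nodup (f : Fin 4 → ℕ) {a b c d : Fin 4} (h : [a, b, c, d].Nodup) :
    ∑ i, f i = f a + f b + f c + f d := by
  have hu : (Finset.univ : Finset (Fin 4)) = [a, b, c, d].toFinset := by
    symm
    rw [← Finset.card_eq_iff_eq_univ, List.toFinset_card_of_nodup h]
    rfl
  rw [hu, List.sum_toFinset f h]
  simp [add_assoc]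

/-- The four kinds of vertices of a jacket are the faces of two pairings of the colours; the better
of the two bounds obtained from these pairings is at most their mean. -/
theorem divergenceDegree_le_of_colourCycle [Fintype W] [Fintype B]
    (hG : G.toSimpleGraph.Connected) (lam : ℂ) (σ : ColourCycle) :
    divergenceDegree (rescaledAmplitude G lam) ≤
      ((2 - (2 - (eulerChar G σ.1 : ℝ)) / 2 : ℝ) : EReal) := by
  have hn0 := nodup_orbit σ 0
  have hn1 := nodup_orbit σ (σ.1 0)
  obtain ⟨k0, hk0⟩ := exists_pairingExponent_eq G hG hn0
  obtain ⟨k1, hk1⟩ := exists_pairingExponent_eq G hG hn1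
  have hs := sum_eq_of_nodup (fun c => G.numComponents {c, σ.1 c}) hn0
  rw [iterate_four σ.1 σ.2.1 σ.2.2] at hk1
  simp only [iterate_four σ.1 σ.2.1 σ.2.2] at hs
  have hchi : (eulerChar G σ.1 : ℝ) + 2 * Fintype.card W + 2 =
      G.pairingExponent k0 + G.pairingExponent k1 := by
    have h : eulerChar G σ.1 + 2 * Fintype.card W + 2 =
        G.pairingExponent k0 + G.pairingExponent k1 := by
      rw [eulerChar_eq, hs, hk0, hk1]
      push_cast
      ring
    exact_mod_cast h
  rcases le_total (G.pairingExponent k0) (G.pairingExponent k1) with h | h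
  · refine (divergenceDegree_le_pairingExponent G lam k0).trans (EReal.coe_le_coe_iff.2 ?_)
    have : (G.pairingExponent k0 : ℝ) ≤ G.pairingExponent k1 := by exact_mod_cast h
    linarith
  · refine (divergenceDegree_le_pairingExponent G lam k1).trans (EReal.coe_le_coe_iff.2 ?_)
    have : (G.pairingExponent k1 : ℝ) ≤ G.pairingExponent k0 := by exact_mod_cast h
    linarith

theorem divergenceDegree_le_jacket [Fintype W] [Fintype B]
    (hG : G.toSimpleGraph.Connected) (lam : ℂ) (J : Jacket) :
    divergenceDegree (rescaledAmplitude G lam) ≤ ((2 - genus G J : ℝ) : EReal) := by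
  induction J using Quotient.inductionOn with
  | h σ => exact divergenceDegree_le_of_colourCycle G hG lam σ

end Counting

/-- A cyclic permutation and its inverse are determined by the colour opposite to the first. -/
theorem perm_eq_or_eq_inv : ∀ σ τ : Equiv.Perm (Fin 4),
    [0, σ 0, σ (σ 0), σ (σ (σ 0))].Nodup → [0, τ 0, τ (τ 0), τ (τ (τ 0))].Nodup →
    σ (σ 0) = τ (τ 0) → σ = τ ∨ σ = τ⁻¹ := by
  decide

theorem card_jacket : Fintype.card Jacket = 3 := by
  let f : Jacket → {b : Fin 4 // b ≠ 0} := Quotient.lift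
    (fun σ : ColourCycle => ⟨σ.1 (σ.1 0), by
      have := nodup_orbit σ 0
      simp at this
      exact fun h => this.1.2.1 h.symm⟩) (by
      rintro σ τ (h | h)
      · simp only [h]
      · apply Subtype.ext
        simp only [h]
        rw [Equiv.Perm.inv_eq_iff_eq, Equiv.Perm.inv_eq_iff_eq, iterate_four τ.1 τ.2.1 τ.2.2])
  have hf : Function.Bijective f := by
    constructor
    · intro J J' h
      induction J using Quotient.inductionOn with
      | h σ =>
        induction J' using Quotient.inductionOn with
        | h τ =>
          exact Quotient.sound (perm_eq_or_eq_inv σ.1 τ.1 (nodup_orbit σ 0) (nodup_orbit τ 0)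
            (congrArg Subtype.val h))
    · rintro ⟨b, hb⟩
      -- conjugate the rotation `0 → 1 → 2 → 3 → 0` so that `2` becomes `b`
      refine ⟨Quotient.mk _ ⟨Equiv.swap 2 b * finRotate 4 * (Equiv.swap 2 b)⁻¹,
        isCycle_finRotate.conj, ?_⟩, ?_⟩
      · rw [← Finset.card_eq_iff_eq_univ, Equiv.Perm.card_support_conj, support_finRotate]
        rfl
      · apply Subtype.ext
        change (Equiv.swap 2 b * finRotate 4 * (Equiv.swap 2 b)⁻¹)
          ((Equiv.swap 2 b * finRotate 4 * (Equiv.swap 2 b)⁻¹) 0) = b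
        have h0 : Equiv.swap 2 b 0 = 0 := Equiv.swap_apply_of_ne_of_ne (by decide) hb.symm
        simp [h0]
  rw [Fintype.card_of_bijective hf]
  decide

end Boulatov

end

/-! ### The bound on the divergence degree -/

theorem mainTheorem3 {W B : Type*} [Fintype W] [Fintype B]
    (G : Boulatov.ColouredGraph W B) (hG : G.toSimpleGraph.Connected) (lam : ℂ) :
    (∀ J : Boulatov.Jacket,
      Boulatov.divergenceDegree (Boulatov.rescaledAmplitude G lam) ≤
        ((2 - Boulatov.genus G J : ℝ) : EReal)) ∧
    Boulatov.divergenceDegree (Boulatov.rescaledAmplitude G lam) ≤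
      ((2 - ⨆ J : Boulatov.Jacket, Boulatov.genus G J : ℝ) : EReal) ∧
    (2 - ⨆ J : Boulatov.Jacket, Boulatov.genus G J) ≤
      2 - (1 / 3 : ℝ) * ∑ J : Boulatov.Jacket, Boulatov.genus G J ∧
    Boulatov.divergenceDegree (Boulatov.rescaledAmplitude G lam) ≤
      ((2 - (1 / 3 : ℝ) * ∑ J : Boulatov.Jacket, Boulatov.genus G J : ℝ) : EReal) := by
  have h := Boulatov.divergenceDegree_le_jacket G hG lam
  have hne : Nonempty Boulatov.Jacket := Fintype.card_pos_iff.1 (by rw [Boulatov.card_jacket]; simp)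
  obtain ⟨J, hJ⟩ := exists_eq_ciSup_of_finite (f := Boulatov.genus G)
  have hsup := h J
  rw [hJ] at hsup
  have hmean : (1 / 3 : ℝ) * ∑ J : Boulatov.Jacket, Boulatov.genus G J ≤
      ⨆ J : Boulatov.Jacket, Boulatov.genus G J := by
    have := Finset.sum_le_card_nsmul Finset.univ (Boulatov.genus G) _
      fun J _ => le_ciSup (Set.finite_range (Boulatov.genus G)).bddAbove J
    rw [Finset.card_univ, Boulatov.card_jacket, nsmul_eq_mul] at this
    push_cast at this
    linarith
  exact ⟨h, hsup, by linarith, hsup.trans (EReal.coe_le_coe_iff.2 (by linarith))⟩
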